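/- Let $\tau\in(3,4)$, $\alpha=1/(\tau-1)$, $c_i=i^{-\alpha}$ and $\tilde\beta\in\mathbb R$. Let $(T_i)_{i\ge 2}$ be independent random variables, $T_i$ exponentially distributed with mean $i^{\alpha}$, and let $$S_t=1+\tilde\beta t+\sum_{i=2}^{\infty}c_i\big[\mathbf 1_{\{T_i\le t\}}-c_i t\big],\qquad t\ge 0,$$ where the sum is the limit of the partial sums $\sum_{i=2}^n$ as $n\to\infty$, which exists almost surely for each $t\ge0$. For $\vartheta\in\mathbb R$ put $$\Lambda(\vartheta)=\int_0^\infty\Big[\log\big(1+e^{-x^{-\alpha}}(e^{-\vartheta x^{-\alpha}}-1)\big)+\vartheta x^{-\alpha}-\vartheta x^{-2\alpha}\Big]dx .$$ This integral converges absolutely for every $\vartheta$, and $\Lambda$ has a unique minimizer $\theta^*$ on $\mathbb R$, with $\theta^*>0$. For $a\in[0,1]$ define $$I_E(a)=(\tau-1)\int_0^\infty\Big(\frac{e^{\theta^* v}(1-e^{-av})}{e^{\theta^* v}(1-e^{-v})+e^{-v}}-av\Big)\frac{dv}{v^{\tau-1}},$$ an absolutely convergent integral. Then for every $\varepsilon>0$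 and every $a\in[0,1]$, $$\lim_{u\to\infty}\mathbb P\Big(\big|S_{au}-u^{\tau-2}I_E(a)\big|\le\varepsilon u^{\tau-2}\,\Big|\,S_u>0\Big)=1 .$$ -/

import Mathlib

open MeasureTheory ProbabilityTheory Filter Topology

/-- The coefficients `c_i = i ^ (-α)` with `α = 1 / (τ - 1)`. -/
noncomputable def coeffC (τ : ℝ) (i : ℕ) : ℝ := (i : ℝ) ^ (-(1 / (τ - 1)))

/-- The truncation at level `n` of the series defining the thinned Lévy process,
`1 + β t + ∑_{i=2}^n c_i (1{T_i ≤ t} - c_i t)`. -/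
noncomputable def thinnedLevyPartial {Ω : Type*} (τ β : ℝ) (T : ℕ → Ω → ℝ) (n : ℕ) (t : ℝ)
    (ω : Ω) : ℝ :=
  1 + β * t + ∑ i ∈ Finset.Icc 2 n,
    coeffC τ i * (Set.indicator {ω' | T i ω' ≤ t} (fun _ => (1 : ℝ)) ω - coeffC τ i * t)

/-- The thinned Lévy process `S_t = 1 + β t + ∑_{i=2}^∞ c_i (1{T_i ≤ t} - c_i t)`.
The series is not absolutely convergent, so its sum is the limit of the partial sums in the
natural order of the index (an unconditional sum `∑'` would be a junk value). -/
noncomputable def thinnedLevy {Ω : Type*} (τ β : ℝ) (T : ℕ → Ω → ℝ) (t : ℝ) (ω : Ω) : ℝ :=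
  limUnder atTop (fun n : ℕ => thinnedLevyPartial τ β T n t ω)

/-- The function
`f(x; ϑ) = log (1 + exp(-x^(-α)) (exp(-ϑ x^(-α)) - 1)) + ϑ x^(-α) - ϑ x^(-2α)`,
where `α = 1 / (τ - 1)`. -/
noncomputable def tiltF (τ ϑ x : ℝ) : ℝ :=
  Real.log (1 + Real.exp (-x ^ (-(1 / (τ - 1)))) *
      (Real.exp (-ϑ * x ^ (-(1 / (τ - 1)))) - 1))
    + ϑ * x ^ (-(1 / (τ - 1))) - ϑ * x ^ (-2 * (1 / (τ - 1)))

/-- `Λ(ϑ) = ∫_0^∞ f(x; ϑ) dx`. -/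
noncomputable def tiltLambda (τ ϑ : ℝ) : ℝ := ∫ x in Set.Ioi (0 : ℝ), tiltF τ ϑ x

/-- `θ* = argmin Λ` (a chosen minimizer, if there is one). -/
noncomputable def thetaStar (τ : ℝ) : ℝ :=
  Classical.epsilon fun θ : ℝ => ∀ ϑ : ℝ, tiltLambda τ θ ≤ tiltLambda τ ϑ

/-- The integrand of `I_E(a)`, at tilt `θ`. -/
noncomputable def rateIntegrand (τ θ a v : ℝ) : ℝ :=
  (Real.exp (θ * v) * (1 - Real.exp (-(a * v))) /
      (Real.exp (θ * v) * (1 - Real.exp (-v)) + Real.exp (-v)) - a * v) * (1 / v ^ (τ - 1))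

/-- `I_E(a) = (τ - 1) ∫_0^∞ (e^{θ* v} (1 - e^{-a v}) / (e^{θ* v} (1 - e^{-v}) + e^{-v}) - a v)
dv / v^(τ - 1)`. -/
noncomputable def rateIE (τ a : ℝ) : ℝ :=
  (τ - 1) * ∫ v in Set.Ioi (0 : ℝ), rateIntegrand τ (thetaStar τ) a v

/-! The proof compares exponential rates at speed $u^{\tau-1}$. Put $z(x)=x^{-1/(\tau-1)}$. Since
$c_iu=z(i/u^{\tau-1})$, independence turns the cumulant generating function of $(uS_u,uS_{au})$ at
$(\theta,\eta)$ into a drift plus a sum of `logTerm a θ η` over the points $z(i/u^{\tau-1})$.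
Divided by $u^{\tau-1}$ this is a Riemann sum, and it converges to `limitCgf τ a θ η`
(`tendsto_levyCgf_div`). The drift, of order at most $u^2$, disappears because $\tau>3$.

At $\eta=0$ the limit is $\Lambda(\theta)$ for every $a$. Its $\eta$-derivative at $(\theta^*,0)$ is
$I_E(a)$, by the substitution $v=z(x)$ (`rateIE_eq`).

Survival has probability at least $e^{u^{\tau-1}(\Lambda(\theta^*)-\rho)}$ for each $\rho>0$ and
large $u$ (`eventually_exp_le_measureReal_pos`). This follows by tilting slightly above $\theta^*$
and discarding the parts of the exponential moment where $uS_u$ is small or very large. Conversely,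
survival with a deviation of $S_{au}$ by $\varepsilon u^{\tau-2}$ has probability at most
$e^{u^{\tau-1}(\Lambda(\theta^*)-c)}$ for some $c>0$ (`exists_eventually_measureReal_le`). Here
Chebyshev uses tilt $\theta^*$ on $S_u$, which costs nothing on survival, and a small $\eta$ on
$S_{au}$, whose first-order effect is $\eta I_E(a)$. The quotient of the two bounds tends to $0$. -/

/-- The moment generating function of `θ z 1{T ≤ u} + η z 1{T ≤ a u}` for `T` exponential with
rate `z / u`. -/
noncomputable def mgfTerm (a θ η z : ℝ) : ℝ :=
  (1 - Real.exp (-(a * z))) * Real.exp ((θ + η) * z) +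
    (Real.exp (-(a * z)) - Real.exp (-z)) * Real.exp (θ * z) + Real.exp (-z)

/-- The compensated cumulant generating function `log (mgfTerm a θ η z) - (θ + η a) z²`. -/
noncomputable def logTerm (a θ η z : ℝ) : ℝ :=
  Real.log (mgfTerm a θ η z) - (θ + η * a) * z ^ 2

/-- The derivative of `logTerm` in `η`. -/
noncomputable def slopeTerm (a θ η z : ℝ) : ℝ :=
  z * ((1 - Real.exp (-(a * z))) * Real.exp ((θ + η) * z) / mgfTerm a θ η z - a * z)

/-! ### Bounds and monotonicity for a single summand -/

section TermBounds

variable {a θ η z : ℝ}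

lemma one_sub_exp_neg_mul_nonneg (ha : a ∈ Set.Icc (0 : ℝ) 1) (hz : 0 ≤ z) :
    0 ≤ 1 - Real.exp (-(a * z)) := by
  have : 0 ≤ a * z := mul_nonneg ha.1 hz
  have : Real.exp (-(a * z)) ≤ 1 := Real.exp_le_one_iff.2 (by linarith)
  linarith

lemma exp_neg_mul_sub_exp_neg_nonneg (ha : a ∈ Set.Icc (0 : ℝ) 1) (hz : 0 ≤ z) :
    0 ≤ Real.exp (-(a * z)) - Real.exp (-z) := by
  have : a * z ≤ z := by nlinarith [ha.2]
  have : Real.exp (-z) ≤ Real.exp (-(a * z)) := Real.exp_le_exp.2 (by linarith)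
  linarith

lemma mgfTerm_pos (ha : a ∈ Set.Icc (0 : ℝ) 1) (hz : 0 ≤ z) : 0 < mgfTerm a θ η z := by
  have h1 := one_sub_exp_neg_mul_nonneg ha hz
  have h2 := exp_neg_mul_sub_exp_neg_nonneg ha hz
  unfold mgfTerm
  positivity

lemma hasDerivAt_logTerm (ha : a ∈ Set.Icc (0 : ℝ) 1) (hz : 0 ≤ z) :
    HasDerivAt (fun η => logTerm a θ η z) (slopeTerm a θ η z) η := by
  have hE : HasDerivAt (fun η => mgfTerm a θ η z)
      ((1 - Real.exp (-(a * z))) * (Real.exp ((θ + η) * z) * z)) η := by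
    have h : HasDerivAt (fun η : ℝ => (θ + η) * z) z η := by
      simpa using ((hasDerivAt_id η).const_add θ).mul_const z
    exact ((h.exp.const_mul _).add_const _).add_const _
  have h2 : HasDerivAt (fun η : ℝ => (θ + η * a) * z ^ 2) (a * z ^ 2) η := by
    simpa using (((hasDerivAt_id η).mul_const a).const_add θ).mul_const (z ^ 2)
  refine ((hE.log (mgfTerm_pos ha hz).ne').sub h2).congr_deriv ?_
  unfold slopeTerm
  ring

lemma logTerm_zero_zero : logTerm a 0 0 z = 0 := by
  simp [logTerm, mgfTerm]

/-- With no weight on time $au$ only the tilt at time $u$ remains. This identifies the $\eta=0$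
slice with the one-parameter family behind $\Lambda$. -/
lemma logTerm_right_zero (a θ z : ℝ) : logTerm a θ 0 z = logTerm 1 0 θ z := by
  simp only [logTerm, mgfTerm]
  congr 2
  · simp; ring
  · ring

lemma abs_exp_sub_one_le_mul_exp (x : ℝ) : |Real.exp x - 1| ≤ |x| * Real.exp |x| := by
  rcases le_total 0 x with h | h
  · rw [abs_of_nonneg h, abs_of_nonneg (by linarith [Real.add_one_le_exp x])]
    have h1 := Real.add_one_le_exp (-x)
    have h2 : Real.exp (-x) * Real.exp x = 1 := by rw [← Real.exp_add]; simp
    nlinarith [Real.exp_pos x]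
  · rw [abs_of_nonpos h, abs_of_nonpos (by linarith [Real.exp_le_one_iff.2 h])]
    have h1 := Real.add_one_le_exp x
    have h2 : 1 ≤ Real.exp (-x) := Real.one_le_exp (by linarith)
    nlinarith

/-- The constant in the uniform bounds on `slopeTerm` and `logTerm`. -/
noncomputable def termConst (R : ℝ) : ℝ :=
  (1 + 4 * R * Real.exp (2 * R)) * Real.exp (2 * R)

lemma one_le_termConst {R : ℝ} (hR : 0 ≤ R) : 1 ≤ termConst R := by
  have h1 : 1 ≤ Real.exp (2 * R) := Real.one_le_exp (by linarith)
  unfold termConst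
  have : 0 ≤ 4 * R * Real.exp (2 * R) := by positivity
  nlinarith

/-- The quotient is the tilted probability of $\{T\le au\}$, so it lies in $[0,1]$, while
$az\in[0,z]$. -/
lemma abs_slopeTerm_le_sq (ha : a ∈ Set.Icc (0 : ℝ) 1) (hz : 1 ≤ z) :
    |slopeTerm a θ η z| ≤ z ^ 2 := by
  have hz0 : 0 ≤ z := by linarith
  have h1 := one_sub_exp_neg_mul_nonneg ha hz0
  have h2 := exp_neg_mul_sub_exp_neg_nonneg ha hz0
  have hE := mgfTerm_pos (θ := θ) (η := η) ha hz0
  have hr0 : 0 ≤ (1 - Real.exp (-(a * z))) * Real.exp ((θ + η) * z) / mgfTerm a θ η z := by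
    positivity
  have hr1 : (1 - Real.exp (-(a * z))) * Real.exp ((θ + η) * z) / mgfTerm a θ η z ≤ 1 := by
    rw [div_le_one hE]
    unfold mgfTerm
    have : 0 ≤ (Real.exp (-(a * z)) - Real.exp (-z)) * Real.exp (θ * z) := by positivity
    linarith [Real.exp_pos (-z)]
  have h3 : 0 ≤ a * z := mul_nonneg ha.1 hz0
  have h4 : a * z ≤ z := by nlinarith [ha.2]
  unfold slopeTerm
  rw [abs_mul, abs_of_nonneg hz0, sq]
  gcongr
  rw [abs_le]
  constructor <;> linarith

/-- For small $z$ the tilted probability is $az+O(z^2)$: the compensator cancels the first order,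
and the outer factor $z$ gives a cube. -/
lemma abs_slopeTerm_le_cube {R : ℝ} (ha : a ∈ Set.Icc (0 : ℝ) 1) (hz0 : 0 ≤ z) (hz : z ≤ 1)
    (hθ : |θ| ≤ R) (hη : |η| ≤ R) : |slopeTerm a θ η z| ≤ termConst R * z ^ 3 := by
  have hR : 0 ≤ R := (abs_nonneg _).trans hθ
  have h1 := one_sub_exp_neg_mul_nonneg ha hz0
  have h2 := exp_neg_mul_sub_exp_neg_nonneg ha hz0
  have hE := mgfTerm_pos (θ := θ) (η := η) ha hz0
  have h3 : 0 ≤ a * z := mul_nonneg ha.1 hz0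
  have h4 : a * z ≤ z := by nlinarith [ha.2]
  -- $K$ is a Lipschitz constant for $z\mapsto e^{sz}$ at $0$ when $|s|\le 2R$; `termConst R` is
  -- $(1+2K)e^{2R}$, where $e^{2R}$ bounds the inverse of `mgfTerm`.
  set K := 2 * R * Real.exp (2 * R) with hK
  have hK0 : 0 ≤ K := by positivity
  have key : ∀ s : ℝ, |s| ≤ 2 * R → |Real.exp (s * z) - 1| ≤ K * z := by
    intro s hs
    have hsz : |s * z| ≤ 2 * R * z := by
      rw [abs_mul, abs_of_nonneg hz0]; gcongr
    have hsz' : |s * z| ≤ 2 * R := hsz.trans (by nlinarith)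
    calc _ ≤ |s * z| * Real.exp |s * z| := abs_exp_sub_one_le_mul_exp _
      _ ≤ (2 * R * z) * Real.exp (2 * R) := by gcongr
      _ = K * z := by rw [hK]; ring
  have low : ∀ s : ℝ, |s| ≤ 2 * R → Real.exp (-(2 * R)) ≤ Real.exp (s * z) := by
    intro s hs
    apply Real.exp_le_exp.2
    have : |s * z| ≤ 2 * R := by
      rw [abs_mul, abs_of_nonneg hz0]; nlinarith
    linarith [(abs_le.1 this).1]
  have hs1 : |θ + η| ≤ 2 * R := (abs_add_le _ _).trans (by linarith)
  have hs2 : |θ| ≤ 2 * R := by linarith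
  set p := 1 - Real.exp (-(a * z)) with hp
  set q := Real.exp (-(a * z)) - Real.exp (-z) with hq
  have hpq : p + q + Real.exp (-z) = 1 := by rw [hp, hq]; ring
  have hez := Real.exp_pos (-z)
  have hpaz : |p - a * z| ≤ z ^ 2 := by
    have := Real.abs_exp_sub_one_sub_id_le (x := -(a * z))
      (by rw [abs_neg, abs_of_nonneg h3]; linarith)
    rw [abs_le] at this ⊢
    constructor <;> nlinarith
  have hple : p ≤ z := by
    have := Real.add_one_le_exp (-(a * z)); rw [hp]; linarith
  have hE1 : |mgfTerm a θ η z - 1| ≤ K * z := by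
    have e : mgfTerm a θ η z - 1 =
        p * (Real.exp ((θ + η) * z) - 1) + q * (Real.exp (θ * z) - 1) := by
      unfold mgfTerm
      linear_combination hpq
    rw [e]
    calc _ ≤ |p * (Real.exp ((θ + η) * z) - 1)| + |q * (Real.exp (θ * z) - 1)| := abs_add_le _ _
      _ = p * |Real.exp ((θ + η) * z) - 1| + q * |Real.exp (θ * z) - 1| := by
          rw [abs_mul, abs_mul, abs_of_nonneg h1, abs_of_nonneg h2]
      _ ≤ p * (K * z) + q * (K * z) := by gcongr <;> exact key _ (by assumption)
      _ = (p + q) * (K * z) := by ring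
      _ ≤ 1 * (K * z) := by gcongr; linarith
      _ = K * z := one_mul _
  have hElow : Real.exp (-(2 * R)) ≤ mgfTerm a θ η z := by
    have e1 : Real.exp (-(2 * R)) ≤ 1 := Real.exp_le_one_iff.2 (by linarith)
    calc Real.exp (-(2 * R)) = p * Real.exp (-(2 * R)) + q * Real.exp (-(2 * R)) +
          Real.exp (-z) * Real.exp (-(2 * R)) := by rw [← add_mul, ← add_mul, hpq, one_mul]
      _ ≤ p * Real.exp ((θ + η) * z) + q * Real.exp (θ * z) + Real.exp (-z) * 1 :=
          add_le_add (add_le_add (mul_le_mul_of_nonneg_left (low _ hs1) h1)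
            (mul_le_mul_of_nonneg_left (low _ hs2) h2)) (mul_le_mul_of_nonneg_left e1 hez.le)
      _ = _ := by rw [mul_one]; rfl
  have hnum : |p * Real.exp ((θ + η) * z) - a * z * mgfTerm a θ η z| ≤ (1 + 2 * K) * z ^ 2 := by
    have e : p * Real.exp ((θ + η) * z) - a * z * mgfTerm a θ η z =
        p * (Real.exp ((θ + η) * z) - 1) + (p - a * z) - a * z * (mgfTerm a θ η z - 1) := by ring
    rw [e]
    calc _ ≤ |p * (Real.exp ((θ + η) * z) - 1)| + |p - a * z|
            + |a * z * (mgfTerm a θ η z - 1)| :=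
          (abs_sub _ _).trans (by gcongr; exact abs_add_le _ _)
      _ = p * |Real.exp ((θ + η) * z) - 1| + |p - a * z| + a * z * |mgfTerm a θ η z - 1| := by
          rw [abs_mul, abs_mul, abs_of_nonneg h1, abs_of_nonneg h3]
      _ ≤ z * (K * z) + z ^ 2 + z * (K * z) := by gcongr; exact key _ hs1
      _ = _ := by ring
  have e : slopeTerm a θ η z =
      z * ((p * Real.exp ((θ + η) * z) - a * z * mgfTerm a θ η z) / mgfTerm a θ η z) := by
    rw [sub_div, mul_div_cancel_right₀ _ hE.ne']
    rfl
  rw [e, abs_mul, abs_div, abs_of_nonneg hz0, abs_of_pos hE]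
  calc _ ≤ z * (((1 + 2 * K) * z ^ 2) / Real.exp (-(2 * R))) := by gcongr
    _ = termConst R * z ^ 3 := by
      rw [Real.exp_neg, div_inv_eq_mul, hK]; unfold termConst; ring

lemma abs_slopeTerm_le {R : ℝ} (ha : a ∈ Set.Icc (0 : ℝ) 1) (hz : 0 ≤ z)
    (hθ : |θ| ≤ R) (hη : |η| ≤ R) :
    |slopeTerm a θ η z| ≤ termConst R * min (z ^ 2) (z ^ 3) := by
  have hR : 0 ≤ R := (abs_nonneg _).trans hθ
  rcases le_total z 1 with h | h
  · rw [min_eq_right (pow_le_pow_of_le_one hz h (by norm_num))]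
    exact abs_slopeTerm_le_cube ha hz h hθ hη
  · rw [min_eq_left (pow_le_pow_right₀ h (by norm_num))]
    have := abs_slopeTerm_le_sq (θ := θ) (η := η) ha h
    nlinarith [one_le_termConst hR, sq_nonneg z]

lemma abs_logTerm_sub_le {R : ℝ} (ha : a ∈ Set.Icc (0 : ℝ) 1) (hz : 0 ≤ z)
    (hθ : |θ| ≤ R) (hη : |η| ≤ R) :
    |logTerm a θ η z - logTerm a θ 0 z| ≤ termConst R * min (z ^ 2) (z ^ 3) * R := by
  have hR : 0 ≤ R := (abs_nonneg _).trans hθ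
  have h := Convex.norm_image_sub_le_of_norm_hasDerivWithin_le (f := fun η => logTerm a θ η z)
    (f' := fun η => slopeTerm a θ η z) (s := Set.Icc (-R) R) (x := 0) (y := η)
    (C := termConst R * min (z ^ 2) (z ^ 3))
    (fun x _ => (hasDerivAt_logTerm ha hz).hasDerivWithinAt)
    (fun x hx => abs_slopeTerm_le ha hz hθ (abs_le.2 hx)) (convex_Icc _ _)
    ⟨by linarith, hR⟩ (abs_le.1 hη)
  simp only [Real.norm_eq_abs, sub_zero] at h
  have h0 : 0 ≤ termConst R * min (z ^ 2) (z ^ 3) := by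
    have := one_le_termConst hR
    have : 0 ≤ min (z ^ 2) (z ^ 3) := le_min (by positivity) (by positivity)
    positivity
  exact h.trans (by gcongr)

/-- Integrate the slope bound along two legs, $(0,0)\to(\theta,0)\to(\theta,\eta)$;
`logTerm_right_zero` makes the first leg an $\eta$-leg with $a=1$. -/
lemma abs_logTerm_le {R : ℝ} (ha : a ∈ Set.Icc (0 : ℝ) 1) (hz : 0 ≤ z)
    (hθ : |θ| ≤ R) (hη : |η| ≤ R) :
    |logTerm a θ η z| ≤ 2 * R * termConst R * min (z ^ 2) (z ^ 3) := by
  have hR : 0 ≤ R := (abs_nonneg _).trans hθ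
  have h1 := abs_logTerm_sub_le ha hz hθ hη
  have h2 := abs_logTerm_sub_le (a := 1) (θ := 0) (η := θ) ⟨zero_le_one, le_rfl⟩ hz
    (by simpa using hR) hθ
  rw [logTerm_zero_zero, sub_zero, ← logTerm_right_zero a] at h2
  calc _ = |(logTerm a θ η z - logTerm a θ 0 z) + logTerm a θ 0 z| := by ring_nf
    _ ≤ _ := abs_add_le _ _
    _ ≤ _ := by linarith

lemma slopeTerm_strictMono (hz : 0 < z) : StrictMono fun η => slopeTerm 1 0 η z := by
  intro x y hxy
  have hp : 0 < 1 - Real.exp (-z) := by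
    have := Real.exp_lt_one_iff.2 (show -z < 0 by linarith); linarith
  have hxy' : Real.exp (x * z) < Real.exp (y * z) := Real.exp_lt_exp.2 (by nlinarith)
  have := Real.exp_pos (x * z)
  have := Real.exp_pos (y * z)
  have := Real.exp_pos (-z)
  simp only [slopeTerm, mgfTerm, one_mul, sub_self, zero_mul, add_zero, zero_add]
  gcongr z * (?_ - z)
  rw [div_lt_div_iff₀ (by positivity) (by positivity)]
  have : (1 - Real.exp (-z)) * Real.exp (-z) * Real.exp (x * z) <
    (1 - Real.exp (-z)) * Real.exp (-z) * Real.exp (y * z) := by gcongr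
  nlinarith

/-- Under an infinite tilt the event $\{T\le u\}$ gets probability one. -/
lemma slopeTerm_tendsto (hz : 0 < z) :
    Tendsto (fun n : ℕ => slopeTerm 1 0 n z) atTop (𝓝 (z * (1 - z))) := by
  have hp : 0 < 1 - Real.exp (-z) := by
    have := Real.exp_lt_one_iff.2 (show -z < 0 by linarith); linarith
  have h0 : Tendsto (fun n : ℕ => Real.exp (-(n * z))) atTop (𝓝 0) :=
    Real.tendsto_exp_neg_atTop_nhds_zero.comp
      ((tendsto_natCast_atTop_atTop (R := ℝ)).atTop_mul_const hz)
  have h1 : Tendsto (fun n : ℕ => z * ((1 - Real.exp (-z)) /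
      ((1 - Real.exp (-z)) + Real.exp (-z) * Real.exp (-(n * z))) - z)) atTop
      (𝓝 (z * ((1 - Real.exp (-z)) / ((1 - Real.exp (-z)) + Real.exp (-z) * 0) - z))) := by
    refine Tendsto.const_mul _ (Tendsto.sub_const (Tendsto.div tendsto_const_nhds
      ((h0.const_mul _).const_add _) ?_) _)
    rw [mul_zero, add_zero]; exact hp.ne'
  rw [mul_zero, add_zero, div_self hp.ne'] at h1
  refine h1.congr fun n => ?_
  simp only [slopeTerm, mgfTerm, one_mul, sub_self, zero_mul, add_zero, zero_add]
  congr 2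
  have hn := Real.exp_pos (n * z)
  have hn' := Real.exp_pos (-z)
  rw [Real.exp_neg (n * z), div_eq_div_iff (by positivity) (by positivity)]
  field_simp

lemma slopeTerm_zero_neg (hz : 0 < z) : slopeTerm 1 0 0 z < 0 := by
  have h := Real.add_one_lt_exp (x := -z) (by linarith)
  simp only [slopeTerm, mgfTerm, one_mul, sub_self, zero_mul, add_zero, Real.exp_zero, mul_one,
    sub_add_cancel, div_one]
  nlinarith

lemma continuous_mgfTerm (a θ η : ℝ) : Continuous (mgfTerm a θ η) := by
  unfold mgfTerm; fun_prop

lemma continuousOn_logTerm (ha : a ∈ Set.Icc (0 : ℝ) 1) :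
    ContinuousOn (logTerm a θ η) (Set.Ici 0) := by
  unfold logTerm
  refine ContinuousOn.sub (ContinuousOn.log (continuous_mgfTerm _ _ _).continuousOn
    fun z hz => (mgfTerm_pos ha hz).ne') (by fun_prop)

lemma continuousOn_slopeTerm (ha : a ∈ Set.Icc (0 : ℝ) 1) :
    ContinuousOn (slopeTerm a θ η) (Set.Ici 0) := by
  unfold slopeTerm
  refine ContinuousOn.mul continuousOn_id (ContinuousOn.sub (ContinuousOn.div (by fun_prop)
    (continuous_mgfTerm _ _ _).continuousOn fun z hz => (mgfTerm_pos ha hz).ne') (by fun_prop))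

end TermBounds

/-! ### Riemann sums on the half-line -/

section RiemannSum

variable {G h : ℝ → ℝ}

/-- The sum is the integral of a step function sampling $G$ at right endpoints of cells of length
$1/N$. A sample point is thus never left of $x$, so an antitone $h$ dominates the step function.
Starting at index $2$ removes the cell $(0,1/N]$. -/
lemma hasSum_riemannCell (hG : ∀ x, 0 < x → |G x| ≤ h x)
    (hh : AntitoneOn h (Set.Ioi 0)) (hint : IntegrableOn h (Set.Ioi 0)) {N : ℝ} (hN : 0 < N) :
    HasSum (fun i : ℕ => N⁻¹ * G ((i + 2 : ℕ) / N))
      (∫ x in Set.Ioi 0, (Set.Ioi (1 / N)).indicator (fun x => G ((⌈x * N⌉₊ : ℕ) / N)) x) := by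
  have hmeas : Measurable fun x : ℝ => G ((⌈x * N⌉₊ : ℕ) / N) :=
    (measurable_from_nat (f := fun n : ℕ => G (n / N))).comp
      (Nat.measurable_ceil.comp (measurable_id.mul_const N))
  have hsub : Set.Ioi (1 / N) ⊆ Set.Ioi 0 := Set.Ioi_subset_Ioi (by positivity)
  have hI : IntegrableOn (fun x : ℝ => G ((⌈x * N⌉₊ : ℕ) / N)) (Set.Ioi (1 / N)) := by
    refine Integrable.mono' (hint.mono_set hsub) hmeas.aestronglyMeasurable ?_
    refine (ae_restrict_iff' measurableSet_Ioi).2 (Eventually.of_forall fun x hx => ?_)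
    have hx0 : 0 < x := hsub hx
    have hle : x ≤ (⌈x * N⌉₊ : ℕ) / N := by
      rw [le_div_iff₀ hN]; exact Nat.le_ceil _
    exact (hG _ (hx0.trans_le hle)).trans (hh hx0 (hx0.trans_le hle) hle)
  rw [setIntegral_indicator measurableSet_Ioi, Set.inter_eq_right.2 hsub]
  have hU : Set.Ioi (1 / N) = ⋃ i : ℕ, Set.Ioc (((i + 1 : ℕ) : ℝ) / N) ((i + 2 : ℕ) / N) := by
    ext x
    simp only [Set.mem_Ioi, Set.mem_iUnion, Set.mem_Ioc, div_lt_iff₀ hN, le_div_iff₀ hN]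
    constructor
    · intro hx
      have h2 : 2 ≤ ⌈x * N⌉₊ := Nat.lt_ceil.2 (by simpa using hx)
      refine ⟨⌈x * N⌉₊ - 2, ?_, ?_⟩
      · exact Nat.lt_ceil.1 (by omega)
      · rw [Nat.sub_add_cancel h2]; exact Nat.le_ceil _
    · rintro ⟨i, hi, -⟩
      refine lt_of_le_of_lt ?_ hi
      push_cast; linarith [(Nat.cast_nonneg i : (0 : ℝ) ≤ i)]
  have hceil : ∀ (i : ℕ) (x : ℝ), x ∈ Set.Ioc (((i + 1 : ℕ) : ℝ) / N) ((i + 2 : ℕ) / N) →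
      ⌈x * N⌉₊ = i + 2 := by
    intro i x hx
    rw [Set.mem_Ioc, div_lt_iff₀ hN, le_div_iff₀ hN] at hx
    rw [Nat.ceil_eq_iff (by omega)]
    exact hx
  have hs := hasSum_integral_iUnion (f := fun x : ℝ => G ((⌈x * N⌉₊ : ℕ) / N))
    (μ := volume) (s := fun i : ℕ => Set.Ioc (((i + 1 : ℕ) : ℝ) / N) ((i + 2 : ℕ) / N))
    (fun i => measurableSet_Ioc) ?_ (hU ▸ hI)
  · have hcell : ∀ i : ℕ, ∫ x in Set.Ioc (((i + 1 : ℕ) : ℝ) / N) ((i + 2 : ℕ) / N),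
        G ((⌈x * N⌉₊ : ℕ) / N) = N⁻¹ * G ((i + 2 : ℕ) / N) := by
      intro i
      rw [setIntegral_congr_fun (g := fun _ => G ((i + 2 : ℕ) / N)) measurableSet_Ioc
        (fun x hx => by simp only [hceil i x hx]), setIntegral_const, smul_eq_mul, Measure.real,
        Real.volume_Ioc, ENNReal.toReal_ofReal]
      · congr 1; push_cast; field_simp; ring
      · rw [sub_nonneg]; gcongr; omega
    rw [hU]
    simpa only [hcell] using hs
  · intro i j hij
    refine Set.disjoint_left.2 fun x hx hx' => hij ?_
    have := hceil i x hx; have := hceil j x hx'; omega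

lemma tendsto_riemannSum (hGc : ContinuousOn G (Set.Ioi 0)) (hG : ∀ x, 0 < x → |G x| ≤ h x)
    (hh : AntitoneOn h (Set.Ioi 0)) (hint : IntegrableOn h (Set.Ioi 0)) :
    Tendsto (fun N : ℝ => N⁻¹ * ∑' i : ℕ, G ((i + 2 : ℕ) / N)) atTop
      (𝓝 (∫ x in Set.Ioi 0, G x)) := by
  have key : Tendsto (fun N : ℝ => ∫ x in Set.Ioi 0,
      (Set.Ioi (1 / N)).indicator (fun x => G ((⌈x * N⌉₊ : ℕ) / N)) x) atTop
      (𝓝 (∫ x in Set.Ioi 0, G x)) := by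
    refine tendsto_integral_filter_of_dominated_convergence h ?_ ?_ hint ?_
    · refine Eventually.of_forall fun N => Measurable.aestronglyMeasurable ?_
      exact ((measurable_from_nat (f := fun n : ℕ => G (n / N))).comp
        (Nat.measurable_ceil.comp (measurable_id.mul_const N))).indicator measurableSet_Ioi
    · filter_upwards [eventually_gt_atTop (0 : ℝ)] with N hN
      refine (ae_restrict_iff' measurableSet_Ioi).2 (Eventually.of_forall fun x hx => ?_)
      have hx0 : 0 < x := hx
      have hle : x ≤ (⌈x * N⌉₊ : ℕ) / N := by
        rw [le_div_iff₀ hN]; exact Nat.le_ceil _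
      have h0 : 0 ≤ h x := (abs_nonneg _).trans (hG x hx)
      by_cases hxN : x ∈ Set.Ioi (1 / N)
      · rw [Set.indicator_of_mem hxN]
        exact (hG _ (hx0.trans_le hle)).trans (hh hx0 (hx0.trans_le hle) hle)
      · rw [Set.indicator_of_notMem hxN]; simpa using h0
    · refine (ae_restrict_iff' measurableSet_Ioi).2 (Eventually.of_forall fun x hx => ?_)
      have hx0 : 0 < x := hx
      have h1 : Tendsto (fun N : ℝ => G ((⌈x * N⌉₊ : ℕ) / N)) atTop (𝓝 (G x)) :=
        (hGc.continuousAt (Ioi_mem_nhds hx0)).tendsto.comp (tendsto_nat_ceil_mul_div_atTop hx0.le)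
      refine h1.congr' ?_
      filter_upwards [eventually_gt_atTop (1 / x), eventually_gt_atTop 0] with N hN hN0
      rw [Set.indicator_of_mem]
      rw [Set.mem_Ioi, div_lt_iff₀ hN0]
      rwa [div_lt_iff₀ hx0, mul_comm] at hN
  refine key.congr' ?_
  filter_upwards [eventually_gt_atTop (0 : ℝ)] with N hN
  rw [← tsum_mul_left]
  exact (hasSum_riemannCell hG hh hint hN).tsum_eq.symm

end RiemannSum

/-! ### The power substitution and its integrable majorant -/

section Scale

/-- The function `x ↦ x ^ (-1/(τ-1))`. -/
noncomputable def scaleZ (τ x : ℝ) : ℝ := x ^ (-(1 / (τ - 1)))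

/-- The common dominating function `min (z², z³)` at `z = x ^ (-1/(τ-1))`. -/
noncomputable def domFun (τ x : ℝ) : ℝ := min (scaleZ τ x ^ 2) (scaleZ τ x ^ 3)

variable {τ : ℝ}

lemma scaleZ_pos {x : ℝ} (hx : 0 < x) : 0 < scaleZ τ x := Real.rpow_pos_of_pos hx _

lemma antitoneOn_scaleZ (hτ : τ ∈ Set.Ioo (3 : ℝ) 4) : AntitoneOn (scaleZ τ) (Set.Ioi 0) := by
  intro x hx y _ hxy
  have : 0 < 1 / (τ - 1) := by have := hτ.1; apply one_div_pos.2; linarith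
  exact Real.rpow_le_rpow_of_nonpos hx hxy (by linarith)

lemma antitoneOn_domFun (hτ : τ ∈ Set.Ioo (3 : ℝ) 4) : AntitoneOn (domFun τ) (Set.Ioi 0) := by
  intro x hx y hy hxy
  have h := antitoneOn_scaleZ hτ hx hy hxy
  have h0 := (scaleZ_pos (τ := τ) (x := y) hy).le
  exact min_le_min (by gcongr) (by gcongr)

lemma continuousOn_scaleZ : ContinuousOn (scaleZ τ) (Set.Ioi 0) :=
  continuousOn_id.rpow_const fun _ hx => Or.inl (ne_of_gt hx)

lemma scaleZ_pow {x : ℝ} (hx : 0 < x) (k : ℕ) :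
    scaleZ τ x ^ k = x ^ (-(1 / (τ - 1)) * k) := by
  rw [scaleZ, ← Real.rpow_natCast, ← Real.rpow_mul hx.le]

/-- With $\alpha=1/(\tau-1)$, the square is integrable near $0$ because $2\alpha<1$, and the cube at
infinity because $3\alpha>1$: the two endpoints of $(3,4)$. -/
lemma integrableOn_domFun (hτ : τ ∈ Set.Ioo (3 : ℝ) 4) : IntegrableOn (domFun τ) (Set.Ioi 0) := by
  obtain ⟨h3, h4⟩ := hτ
  have hα1 : 1 / (τ - 1) < 1 / 2 := by
    apply one_div_lt_one_div_of_lt <;> linarith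
  have hα2 : 1 / 3 < 1 / (τ - 1) := by
    apply one_div_lt_one_div_of_lt <;> linarith
  have hm : AEStronglyMeasurable (domFun τ) (volume.restrict (Set.Ioi 0)) := by
    refine ContinuousOn.aestronglyMeasurable ?_ measurableSet_Ioi
    have hc : Continuous fun z : ℝ => min (z ^ 2) (z ^ 3) := by fun_prop
    exact hc.comp_continuousOn continuousOn_scaleZ
  have hnn : ∀ x, 0 < x → 0 ≤ domFun τ x := fun x hx => by
    have := scaleZ_pos (τ := τ) hx
    exact le_min (by positivity) (by positivity)
  rw [← Set.Ioc_union_Ioi_eq_Ioi zero_le_one]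
  refine IntegrableOn.union ?_ ?_
  · have hi : IntegrableOn (fun x : ℝ => x ^ (-(1 / (τ - 1)) * (2 : ℕ))) (Set.Ioc 0 1) := by
      rw [← intervalIntegrable_iff_integrableOn_Ioc_of_le zero_le_one]
      exact intervalIntegral.intervalIntegrable_rpow' (by push_cast; linarith)
    refine Integrable.mono' hi (hm.mono_set Set.Ioc_subset_Ioi_self) ?_
    refine (ae_restrict_iff' measurableSet_Ioc).2 (Eventually.of_forall fun x hx => ?_)
    rw [Real.norm_of_nonneg (hnn x hx.1), ← scaleZ_pow hx.1]
    exact min_le_left _ _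
  · have hi : IntegrableOn (fun x : ℝ => x ^ (-(1 / (τ - 1)) * (3 : ℕ))) (Set.Ioi 1) :=
      integrableOn_Ioi_rpow_of_lt (by push_cast; linarith) one_pos
    refine Integrable.mono' hi (hm.mono_set (Set.Ioi_subset_Ioi zero_le_one)) ?_
    refine (ae_restrict_iff' measurableSet_Ioi).2 (Eventually.of_forall fun x hx => ?_)
    have hx0 : 0 < x := lt_trans one_pos hx
    rw [Real.norm_of_nonneg (hnn x hx0), ← scaleZ_pow hx0]
    exact min_le_right _ _

end Scale

/-! ### The limiting cumulant generating function, its minimizer and the rate -/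

/-- The limiting cumulant generating function `∫_0^∞ logTerm a θ η (x ^ (-1/(τ-1))) dx`. -/
noncomputable def limitCgf (τ a θ η : ℝ) : ℝ :=
  ∫ x in Set.Ioi (0 : ℝ), logTerm a θ η (scaleZ τ x)

/-- The derivative of `limitCgf` in `η`. -/
noncomputable def limitSlope (τ a θ η : ℝ) : ℝ :=
  ∫ x in Set.Ioi (0 : ℝ), slopeTerm a θ η (scaleZ τ x)

section LimitCgf

variable {τ a θ η : ℝ}

lemma continuousOn_logTerm_scaleZ (ha : a ∈ Set.Icc (0 : ℝ) 1) :
    ContinuousOn (fun x => logTerm a θ η (scaleZ τ x)) (Set.Ioi 0) :=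
  (continuousOn_logTerm ha).comp continuousOn_scaleZ fun _ hx => (scaleZ_pos hx).le

lemma continuousOn_slopeTerm_scaleZ (ha : a ∈ Set.Icc (0 : ℝ) 1) :
    ContinuousOn (fun x => slopeTerm a θ η (scaleZ τ x)) (Set.Ioi 0) :=
  (continuousOn_slopeTerm ha).comp continuousOn_scaleZ fun _ hx => (scaleZ_pos hx).le

lemma abs_logTerm_scaleZ_le (ha : a ∈ Set.Icc (0 : ℝ) 1) {x : ℝ} (hx : 0 < x) :
    |logTerm a θ η (scaleZ τ x)| ≤
      2 * (|θ| + |η|) * termConst (|θ| + |η|) * domFun τ x :=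
  abs_logTerm_le ha (scaleZ_pos hx).le (by simp) (by simp)

lemma integrableOn_logTerm (hτ : τ ∈ Set.Ioo (3 : ℝ) 4) (ha : a ∈ Set.Icc (0 : ℝ) 1) :
    IntegrableOn (fun x => logTerm a θ η (scaleZ τ x)) (Set.Ioi 0) := by
  refine Integrable.mono' ((integrableOn_domFun hτ).const_mul
    (2 * (|θ| + |η|) * termConst (|θ| + |η|)))
    ((continuousOn_logTerm_scaleZ ha).aestronglyMeasurable measurableSet_Ioi) ?_
  exact (ae_restrict_iff' measurableSet_Ioi).2
    (Eventually.of_forall fun x hx => abs_logTerm_scaleZ_le ha hx)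

lemma integrableOn_slopeTerm (hτ : τ ∈ Set.Ioo (3 : ℝ) 4) (ha : a ∈ Set.Icc (0 : ℝ) 1) :
    IntegrableOn (fun x => slopeTerm a θ η (scaleZ τ x)) (Set.Ioi 0) := by
  refine Integrable.mono' ((integrableOn_domFun hτ).const_mul (termConst (|θ| + |η|)))
    ((continuousOn_slopeTerm_scaleZ ha).aestronglyMeasurable measurableSet_Ioi) ?_
  exact (ae_restrict_iff' measurableSet_Ioi).2 (Eventually.of_forall fun x hx =>
    abs_slopeTerm_le ha (scaleZ_pos hx).le (by simp) (by simp))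

lemma hasDerivAt_limitCgf (hτ : τ ∈ Set.Ioo (3 : ℝ) 4) (ha : a ∈ Set.Icc (0 : ℝ) 1) :
    HasDerivAt (limitCgf τ a θ) (limitSlope τ a θ η) η := by
  have h := hasDerivAt_integral_of_dominated_loc_of_deriv_le (μ := volume.restrict (Set.Ioi 0))
    (F := fun η x => logTerm a θ η (scaleZ τ x)) (F' := fun η x => slopeTerm a θ η (scaleZ τ x))
    (x₀ := η) (s := Metric.ball η 1) (bound := fun x => termConst (|θ| + |η| + 1) * domFun τ x)
    (Metric.ball_mem_nhds η one_pos)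
    (Eventually.of_forall fun _ =>
      (continuousOn_logTerm_scaleZ ha).aestronglyMeasurable measurableSet_Ioi)
    (integrableOn_logTerm hτ ha)
    ((continuousOn_slopeTerm_scaleZ ha).aestronglyMeasurable measurableSet_Ioi)
    ((ae_restrict_iff' measurableSet_Ioi).2 (Eventually.of_forall fun x hx y hy =>
      abs_slopeTerm_le ha (scaleZ_pos hx).le (by linarith [abs_nonneg η]) ?_))
    ((integrableOn_domFun hτ).const_mul _)
    ((ae_restrict_iff' measurableSet_Ioi).2 (Eventually.of_forall fun x hx y _ =>
      hasDerivAt_logTerm ha (scaleZ_pos hx).le))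
  · exact h.2
  · rw [Metric.mem_ball, Real.dist_eq] at hy
    have := abs_sub_abs_le_abs_sub y η
    linarith [abs_nonneg θ]

lemma limitCgf_right_zero (τ a θ : ℝ) : limitCgf τ a θ 0 = limitCgf τ 1 0 θ := by
  simp only [limitCgf, logTerm_right_zero a]

/-- Factoring $e^{\vartheta z}$ out of the moment generating function gives the logarithm in
$\Lambda$ plus $\vartheta z$. -/
lemma tiltF_eq {x : ℝ} (hx : 0 < x) (ϑ : ℝ) : tiltF τ ϑ x = logTerm 1 0 ϑ (scaleZ τ x) := by
  have hz := scaleZ_pos (τ := τ) hx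
  have h2 : x ^ (-2 * (1 / (τ - 1))) = scaleZ τ x ^ 2 := by
    rw [scaleZ_pow hx]; congr 1; push_cast; ring
  have hpos : 0 < 1 + Real.exp (-scaleZ τ x) * (Real.exp (-ϑ * scaleZ τ x) - 1) := by
    have h1 : Real.exp (-scaleZ τ x) ≤ 1 := Real.exp_le_one_iff.2 (by linarith)
    have h3 : 0 < Real.exp (-scaleZ τ x) * Real.exp (-ϑ * scaleZ τ x) := by positivity
    linarith
  have hE : mgfTerm 1 0 ϑ (scaleZ τ x) = Real.exp (ϑ * scaleZ τ x) *
      (1 + Real.exp (-scaleZ τ x) * (Real.exp (-ϑ * scaleZ τ x) - 1)) := by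
    have h4 : Real.exp (ϑ * scaleZ τ x) * Real.exp (-ϑ * scaleZ τ x) = 1 := by
      rw [← Real.exp_add]; simp
    simp only [mgfTerm, one_mul, sub_self, zero_mul, add_zero, zero_add]
    linear_combination -Real.exp (-scaleZ τ x) * h4
  rw [tiltF, h2]
  change Real.log (1 + Real.exp (-scaleZ τ x) * (Real.exp (-ϑ * scaleZ τ x) - 1)) +
    ϑ * scaleZ τ x - ϑ * scaleZ τ x ^ 2 = _
  rw [logTerm, hE, Real.log_mul (Real.exp_pos _).ne' hpos.ne', Real.log_exp]
  ring

lemma integrableOn_tiltF (hτ : τ ∈ Set.Ioo (3 : ℝ) 4) (ϑ : ℝ) :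
    IntegrableOn (tiltF τ ϑ) (Set.Ioi 0) :=
  (integrableOn_congr_fun (fun _ hx => tiltF_eq hx ϑ) measurableSet_Ioi).2
    (integrableOn_logTerm hτ ⟨zero_le_one, le_rfl⟩)

lemma tiltLambda_eq (τ ϑ : ℝ) : tiltLambda τ ϑ = limitCgf τ 1 0 ϑ :=
  setIntegral_congr_fun measurableSet_Ioi fun _ hx => tiltF_eq hx ϑ

/-- Substituting $v=z(x)$ gives $v^{-(\tau-1)}=x$ and Jacobian $\alpha z/x$, with
$\alpha=1/(\tau-1)$; their product $\alpha z$ supplies the outer factor of `slopeTerm`. -/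
lemma rateIntegrand_comp_scaleZ (hτ : τ ∈ Set.Ioo (3 : ℝ) 4) {x : ℝ} (hx : 0 < x) :
    (|-(1 / (τ - 1))| * x ^ (-(1 / (τ - 1)) - 1)) • rateIntegrand τ θ a (x ^ (-(1 / (τ - 1)))) =
      (1 / (τ - 1)) * slopeTerm a θ 0 (scaleZ τ x) := by
  have h1 : 0 < τ - 1 := by linarith [hτ.1]
  have h2 : (scaleZ τ x) ^ (τ - 1) = x⁻¹ := by
    rw [scaleZ, ← Real.rpow_mul hx.le, ← Real.rpow_neg_one]
    congr 1; field_simp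
  have h3 : x ^ (-(1 / (τ - 1)) - 1) = scaleZ τ x * x⁻¹ := by
    rw [Real.rpow_sub_one hx.ne', div_eq_mul_inv]; rfl
  have h4 : mgfTerm a θ 0 (scaleZ τ x) = Real.exp (θ * scaleZ τ x) *
      (1 - Real.exp (-scaleZ τ x)) + Real.exp (-scaleZ τ x) := by
    rw [mgfTerm, add_zero]; ring
  rw [h3, abs_neg, abs_of_pos (by positivity), smul_eq_mul]
  change _ * rateIntegrand τ θ a (scaleZ τ x) = _
  rw [rateIntegrand, h2, slopeTerm, h4, add_zero, one_div x⁻¹, inv_inv]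
  rw [mul_comm (1 - Real.exp (-(a * scaleZ τ x))) (Real.exp (θ * scaleZ τ x))]
  generalize Real.exp (θ * scaleZ τ x) * (1 - Real.exp (-(a * scaleZ τ x))) /
    (Real.exp (θ * scaleZ τ x) * (1 - Real.exp (-scaleZ τ x)) + Real.exp (-scaleZ τ x)) = r
  field_simp

lemma neg_one_div_sub_one_ne_zero (hτ : τ ∈ Set.Ioo (3 : ℝ) 4) : -(1 / (τ - 1)) ≠ 0 := by
  have h1 : 0 < τ - 1 := by linarith [hτ.1]
  exact neg_ne_zero.2 (by positivity)

lemma integrableOn_rateIntegrand (hτ : τ ∈ Set.Ioo (3 : ℝ) 4) (ha : a ∈ Set.Icc (0 : ℝ) 1) :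
    IntegrableOn (rateIntegrand τ θ a) (Set.Ioi 0) := by
  rw [← integrableOn_Ioi_comp_rpow_iff _ (neg_one_div_sub_one_ne_zero hτ)]
  exact (integrableOn_congr_fun (fun x hx => rateIntegrand_comp_scaleZ hτ hx)
    measurableSet_Ioi).2 ((integrableOn_slopeTerm hτ ha).const_mul _)

lemma rateIE_eq (hτ : τ ∈ Set.Ioo (3 : ℝ) 4) (a : ℝ) :
    rateIE τ a = limitSlope τ a (thetaStar τ) 0 := by
  have h1 : 0 < τ - 1 := by linarith [hτ.1]
  rw [rateIE, ← integral_comp_rpow_Ioi _ (neg_one_div_sub_one_ne_zero hτ),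
    setIntegral_congr_fun measurableSet_Ioi (fun x hx => rateIntegrand_comp_scaleZ hτ hx),
    integral_const_mul, limitSlope]
  field_simp

lemma integral_Ioi_pos {f : ℝ → ℝ} (hf : IntegrableOn f (Set.Ioi 0)) (hpos : ∀ x, 0 < x → 0 < f x) :
    0 < ∫ x in Set.Ioi (0 : ℝ), f x := by
  rw [setIntegral_pos_iff_support_of_nonneg_ae
    ((ae_restrict_iff' measurableSet_Ioi).2 (Eventually.of_forall fun x hx => (hpos x hx).le)) hf]
  have : Set.Ioi 0 ⊆ Function.support f ∩ Set.Ioi 0 := fun x hx => ⟨(hpos x hx).ne', hx⟩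
  exact lt_of_lt_of_le (by simp) (measure_mono this)

lemma limitSlope_strictMono (hτ : τ ∈ Set.Ioo (3 : ℝ) 4) : StrictMono (limitSlope τ 1 0) := by
  intro s t hst
  have h1 : (1 : ℝ) ∈ Set.Icc (0 : ℝ) 1 := ⟨zero_le_one, le_rfl⟩
  rw [← sub_pos, limitSlope, limitSlope,
    ← integral_sub (integrableOn_slopeTerm hτ h1) (integrableOn_slopeTerm hτ h1)]
  exact integral_Ioi_pos ((integrableOn_slopeTerm hτ h1).sub (integrableOn_slopeTerm hτ h1))
    fun x hx => sub_pos.2 (slopeTerm_strictMono (scaleZ_pos hx) hst)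

lemma limitSlope_zero_neg (hτ : τ ∈ Set.Ioo (3 : ℝ) 4) : limitSlope τ 1 0 0 < 0 := by
  have h1 : (1 : ℝ) ∈ Set.Icc (0 : ℝ) 1 := ⟨zero_le_one, le_rfl⟩
  rw [← neg_pos, limitSlope, ← integral_neg]
  exact integral_Ioi_pos (integrableOn_slopeTerm hτ h1).neg
    fun x hx => neg_pos.2 (slopeTerm_zero_neg (scaleZ_pos hx))

/-- At infinity $z(1-z)\ge z/2$, and $z$ decays like a power with exponent above $-1$. -/
lemma not_integrableOn_scaleZ_mul (hτ : τ ∈ Set.Ioo (3 : ℝ) 4) :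
    ¬ IntegrableOn (fun x => scaleZ τ x * (1 - scaleZ τ x)) (Set.Ioi 0) := by
  intro h
  have h1 : 0 < τ - 1 := by linarith [hτ.1]
  have ht : Tendsto (scaleZ τ) atTop (𝓝 0) := tendsto_rpow_neg_atTop (by positivity)
  obtain ⟨X, hX⟩ := ((ht.eventually (gt_mem_nhds (show (0 : ℝ) < 1 / 2 by norm_num))).and
    (eventually_gt_atTop 0)).exists_forall_of_atTop
  have hX0 : 0 < X := (hX X le_rfl).2
  have hi : IntegrableOn (fun x : ℝ => x ^ (-(1 / (τ - 1)))) (Set.Ioi X) := by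
    refine Integrable.mono' ((h.mono_set (Set.Ioi_subset_Ioi hX0.le)).const_mul 2)
      ((continuousOn_scaleZ.mono (Set.Ioi_subset_Ioi hX0.le)).aestronglyMeasurable
        measurableSet_Ioi) ?_
    refine (ae_restrict_iff' measurableSet_Ioi).2 (Eventually.of_forall fun x hx => ?_)
    have hz := (hX x (le_of_lt hx)).1
    have hz0 := scaleZ_pos (τ := τ) (x := x) (hX0.trans hx)
    change ‖scaleZ τ x‖ ≤ _
    rw [Real.norm_of_nonneg hz0.le]
    nlinarith
  rw [integrableOn_Ioi_rpow_iff hX0] at hi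
  have : 1 / (τ - 1) < 1 := by rw [div_lt_one h1]; linarith [hτ.1]
  linarith

/-- If all slopes were nonpositive, the nonnegative increments from tilt $0$ to tilt $n$ would have
bounded integrals. Fatou would then make their limit integrable, hence also $z(1-z)$, which it is
not. -/
lemma exists_limitSlope_pos (hτ : τ ∈ Set.Ioo (3 : ℝ) 4) : ∃ n : ℕ, 0 < limitSlope τ 1 0 n := by
  by_contra! hneg
  have h1 : (1 : ℝ) ∈ Set.Icc (0 : ℝ) 1 := ⟨zero_le_one, le_rfl⟩
  have hI := fun t : ℝ => integrableOn_slopeTerm (θ := 0) (η := t) hτ h1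
  have hint : IntegrableOn (fun x => scaleZ τ x * (1 - scaleZ τ x) - slopeTerm 1 0 0 (scaleZ τ x))
      (Set.Ioi 0) := by
    refine integrable_of_tendsto
      (G := fun n x => slopeTerm 1 0 n (scaleZ τ x) - slopeTerm 1 0 0 (scaleZ τ x)) ?_ ?_ ?_
    · exact (ae_restrict_iff' measurableSet_Ioi).2 (Eventually.of_forall fun x hx =>
        (slopeTerm_tendsto (scaleZ_pos hx)).sub_const _)
    · exact fun n => ((hI n).sub (hI 0)).aestronglyMeasurable
    · have hle : ∀ n : ℕ, ∫⁻ x in Set.Ioi (0 : ℝ),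
          ‖slopeTerm 1 0 n (scaleZ τ x) - slopeTerm 1 0 0 (scaleZ τ x)‖ₑ ≤
          ENNReal.ofReal (-limitSlope τ 1 0 0) := by
        intro n
        have hnn : ∀ᵐ x ∂(volume.restrict (Set.Ioi (0 : ℝ))),
            0 ≤ slopeTerm 1 0 n (scaleZ τ x) - slopeTerm 1 0 0 (scaleZ τ x) :=
          (ae_restrict_iff' measurableSet_Ioi).2 (Eventually.of_forall fun x hx =>
            sub_nonneg.2 ((slopeTerm_strictMono (scaleZ_pos hx)).monotone n.cast_nonneg))
        refine (ofReal_integral_norm_eq_lintegral_enorm ((hI n).sub (hI 0))).symm.trans_le ?_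
        refine ENNReal.ofReal_le_ofReal ?_
        simp only [Pi.sub_apply]
        rw [integral_congr_ae (hnn.mono fun x hx => Real.norm_of_nonneg hx),
          integral_sub (hI n) (hI 0)]
        have := hneg n
        rw [limitSlope] at this ⊢
        linarith
      refine ne_top_of_le_ne_top (ENNReal.ofReal_ne_top (r := -limitSlope τ 1 0 0))
        ((liminf_le_liminf (Eventually.of_forall hle)).trans (by simp))
  exact not_integrableOn_scaleZ_mul hτ ((hint.add (hI 0)).congr
    (Eventually.of_forall fun x => by simp))

lemma exists_limitSlope_eq_zero (hτ : τ ∈ Set.Ioo (3 : ℝ) 4) :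
    ∃ θ, 0 < θ ∧ limitSlope τ 1 0 θ = 0 := by
  obtain ⟨n, hn⟩ := exists_limitSlope_pos hτ
  -- Darboux's theorem for derivatives: continuity of the slope is not needed.
  obtain ⟨c, hc, h⟩ := exists_hasDerivWithinAt_eq_of_gt_of_lt (f := limitCgf τ 1 0)
    (f' := limitSlope τ 1 0) (a := 0) (b := n) (m := 0) n.cast_nonneg
    (fun x _ => (hasDerivAt_limitCgf hτ ⟨zero_le_one, le_rfl⟩).hasDerivWithinAt)
    (limitSlope_zero_neg hτ) hn
  exact ⟨c, hc.1, h⟩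

lemma limitCgf_lt_of_limitSlope_eq_zero (hτ : τ ∈ Set.Ioo (3 : ℝ) 4) {θ ϑ : ℝ}
    (hθ : limitSlope τ 1 0 θ = 0) (h : ϑ ≠ θ) : limitCgf τ 1 0 θ < limitCgf τ 1 0 ϑ := by
  have hd := fun t : ℝ => hasDerivAt_limitCgf (θ := 0) (η := t) hτ ⟨zero_le_one, le_refl (1 : ℝ)⟩
  have hcont : Continuous (limitCgf τ 1 0) :=
    continuous_iff_continuousAt.2 fun t => (hd t).continuousAt
  rcases lt_or_gt_of_ne h with h | h
  · refine strictAntiOn_of_deriv_neg (convex_Iic θ) hcont.continuousOn (fun x hx => ?_)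
      h.le Set.self_mem_Iic h
    rw [interior_Iic] at hx
    rw [(hd x).deriv]
    exact (limitSlope_strictMono hτ hx).trans_eq hθ
  · refine strictMonoOn_of_deriv_pos (convex_Ici θ) hcont.continuousOn (fun x hx => ?_)
      Set.self_mem_Ici h.le h
    rw [interior_Ici] at hx
    rw [(hd x).deriv]
    exact hθ.symm.trans_lt (limitSlope_strictMono hτ hx)

/-- The slope is strictly increasing and has a zero, so the minimizer is unique and the choice made
by `Classical.epsilon` must be that zero. -/
lemma thetaStar_spec (hτ : τ ∈ Set.Ioo (3 : ℝ) 4) :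
    0 < thetaStar τ ∧ limitSlope τ 1 0 (thetaStar τ) = 0 := by
  obtain ⟨θ, hθ0, hθ⟩ := exists_limitSlope_eq_zero hτ
  have hmin : ∀ ϑ, tiltLambda τ θ ≤ tiltLambda τ ϑ := by
    intro ϑ
    rw [tiltLambda_eq, tiltLambda_eq]
    rcases eq_or_ne ϑ θ with rfl | h
    · exact le_rfl
    · exact (limitCgf_lt_of_limitSlope_eq_zero hτ hθ h).le
  have hs : ∀ ϑ, tiltLambda τ (thetaStar τ) ≤ tiltLambda τ ϑ :=
    Classical.epsilon_spec (p := fun θ : ℝ => ∀ ϑ : ℝ, tiltLambda τ θ ≤ tiltLambda τ ϑ) ⟨θ, hmin⟩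
  have he : thetaStar τ = θ := by
    by_contra hne
    have h2 := hs θ
    rw [tiltLambda_eq, tiltLambda_eq] at h2
    exact absurd (limitCgf_lt_of_limitSlope_eq_zero hτ hθ hne) (not_lt.2 h2)
  rw [he]
  exact ⟨hθ0, hθ⟩

end LimitCgf

/-! ### Almost sure convergence of random series -/

section OneSeries

variable {Ω : Type*} [MeasurableSpace Ω] {P : Measure Ω}

lemma memLp_sum_range {Y : ℕ → Ω → ℝ} (hL : ∀ n, MemLp (Y n) 2 P) (n : ℕ) :
    MemLp (∑ k ∈ Finset.range n, Y k) 2 P :=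
  memLp_finsetSum' _ fun k _ => hL k

/-- Kolmogorov's one-series theorem: a series of independent centred random variables with
summable variances converges almost surely. -/
theorem ae_exists_tendsto_sum_of_summable_variance [IsProbabilityMeasure P] {Y : ℕ → Ω → ℝ}
    (hm : ∀ n, Measurable (Y n)) (hind : iIndepFun Y P) (hL : ∀ n, MemLp (Y n) 2 P)
    (h0 : ∀ n, ∫ ω, Y n ω ∂P = 0) (hv : Summable fun n => variance (Y n) P) :
    ∀ᵐ ω ∂P, ∃ c, Tendsto (fun n => ∑ k ∈ Finset.range n, Y k ω) atTop (𝓝 c) := by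
  have hsm : ∀ n, StronglyMeasurable (Y n) := fun n => (hm n).stronglyMeasurable
  let ℱ := Filtration.natural Y hsm
  -- The shift by one makes `M n` adapted to `ℱ n`. It is a martingale bounded in $L^2$, hence in
  -- $L^1$ by $|x|\le 1+x^2$, and Doob's theorem applies.
  let M : ℕ → Ω → ℝ := fun n => ∑ k ∈ Finset.range (n + 1), Y k
  have hML : ∀ n, MemLp (M n) 2 P := fun n => memLp_sum_range hL (n + 1)
  have hMi : ∀ n, Integrable (M n) P := fun n => (hML n).integrable one_le_two
  have hadp : StronglyAdapted ℱ M := fun n =>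
    Finset.stronglyMeasurable_sum _ fun k hk =>
      (Filtration.stronglyAdapted_natural hsm k).mono
        (ℱ.mono (Nat.lt_succ_iff.1 (Finset.mem_range.1 hk)))
  have hsub : Submartingale M ℱ P := by
    refine submartingale_nat hadp hMi fun n => ?_
    have e : M (n + 1) = M n + Y (n + 1) := Finset.sum_range_succ _ _
    have h1 : P[M (n + 1) | ℱ n] =ᵐ[P] P[M n | ℱ n] + P[Y (n + 1) | ℱ n] := by
      rw [e]; exact condExp_add (hMi n) ((hL _).integrable one_le_two) _
    have h2 : P[M n | ℱ n] = M n := condExp_of_stronglyMeasurable (ℱ.le n) (hadp n) (hMi n)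
    have h3 := hind.condExp_natural_ae_eq_of_lt hsm (Nat.lt_succ_self n)
    filter_upwards [h1, h3] with ω hω hω'
    rw [hω, Pi.add_apply, h2, hω', h0, add_zero]
  have hM0 : ∀ n, ∫ ω, M n ω ∂P = 0 := by
    intro n
    simp only [M, Finset.sum_apply]
    rw [integral_finsetSum _ fun k _ => (hL k).integrable one_le_two]
    exact Finset.sum_eq_zero fun k _ => h0 k
  have hsq : ∀ n, ∫ ω, M n ω ^ 2 ∂P ≤ ∑' k, variance (Y k) P := by
    intro n
    have h1 : variance (M n) P = ∑ k ∈ Finset.range (n + 1), variance (Y k) P :=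
      IndepFun.variance_sum (fun k _ => hL k) fun i _ j _ hij => hind.indepFun hij
    rw [variance_of_integral_eq_zero (hMi n).aemeasurable (hM0 n)] at h1
    rw [h1]
    exact hv.sum_le_tsum _ fun k _ => variance_nonneg _ _
  have hbdd : ∀ n, eLpNorm (M n) 1 P ≤ (Real.toNNReal (1 + ∑' k, variance (Y k) P) : NNReal) := by
    intro n
    rw [eLpNorm_one_eq_lintegral_enorm, ← ofReal_integral_norm_eq_lintegral_enorm (hMi n)]
    change _ ≤ ENNReal.ofReal _
    refine ENNReal.ofReal_le_ofReal ?_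
    calc ∫ ω, ‖M n ω‖ ∂P ≤ ∫ ω, (1 + M n ω ^ 2) ∂P := by
          refine integral_mono (hMi n).norm ((integrable_const _).add (hML n).integrable_sq)
            fun ω => ?_
          simp only [Real.norm_eq_abs]
          nlinarith [sq_abs (M n ω), sq_nonneg (|M n ω| - 1), sq_nonneg (M n ω)]
      _ = 1 + ∫ ω, M n ω ^ 2 ∂P := by
          rw [integral_add (integrable_const _) (hML n).integrable_sq]; simp
      _ ≤ _ := by linarith [hsq n]
  filter_upwards [hsub.exists_ae_tendsto_of_bdd hbdd] with ω ⟨c, hc⟩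
  refine ⟨c, (tendsto_add_atTop_iff_nat 1).1 ?_⟩
  simpa only [M, Finset.sum_apply] using hc

end OneSeries

/-! ### Exponential clocks and the moment of one summand -/

section Exponential

variable {Ω : Type*} [MeasurableSpace Ω] {P : Measure Ω}

lemma measureReal_le_of_map_eq_expMeasure {X : Ω → ℝ} (hX : Measurable X) {c : ℝ} (hc : 0 < c)
    (hl : P.map X = expMeasure c) {t : ℝ} (ht : 0 ≤ t) :
    P.real {ω | X ω ≤ t} = 1 - Real.exp (-(c * t)) := by
  have := isProbabilityMeasure_expMeasure hc
  have h := cdf_expMeasure_eq hc t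
  rw [if_pos ht, cdf_eq_real, ← hl, map_measureReal_apply hX measurableSet_Iic] at h
  exact h

lemma integral_indicator_Iic_comp {X : Ω → ℝ} (hX : Measurable X) {c : ℝ} (hc : 0 < c)
    (hl : P.map X = expMeasure c) {t : ℝ} (ht : 0 ≤ t) :
    ∫ ω, (Set.Iic t).indicator (fun _ => (1 : ℝ)) (X ω) ∂P = 1 - Real.exp (-(c * t)) := by
  have e : (fun ω => (Set.Iic t).indicator (fun _ => (1 : ℝ)) (X ω)) =
      (X ⁻¹' Set.Iic t).indicator (fun _ => (1 : ℝ)) := rfl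
  rw [e, integral_indicator (hX measurableSet_Iic), setIntegral_const, smul_eq_mul, mul_one]
  exact measureReal_le_of_map_eq_expMeasure hX hc hl ht

lemma integrable_indicator_Iic_comp [IsFiniteMeasure P] {X : Ω → ℝ} (hX : Measurable X) (t : ℝ) :
    Integrable (fun ω => (Set.Iic t).indicator (fun _ => (1 : ℝ)) (X ω)) P :=
  (integrable_const (1 : ℝ)).indicator (hX measurableSet_Iic)

/-- The exponential of the compensated contribution of a single summand to
`θ u S_u + η u S_{a u}`, as a function of the exponential variable. -/
noncomputable def expSummand (a θ η u c x : ℝ) : ℝ :=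
  Real.exp (θ * u * (c * ((Set.Iic u).indicator (fun _ => 1) x - c * u)) +
    η * u * (c * ((Set.Iic (a * u)).indicator (fun _ => 1) x - c * (a * u))))

lemma measurable_expSummand (a θ η u c : ℝ) : Measurable (expSummand a θ η u c) := by
  have h : ∀ t : ℝ, Measurable ((Set.Iic t).indicator (fun _ => (1 : ℝ))) := fun t =>
    measurable_const.indicator measurableSet_Iic
  unfold expSummand
  have := h u
  have := h (a * u)
  fun_prop

lemma integral_expSummand [IsProbabilityMeasure P] {X : Ω → ℝ} (hX : Measurable X) {c : ℝ}
    (hc : 0 < c) (hl : P.map X = expMeasure c) {a θ η u : ℝ} (ha : a ∈ Set.Icc (0 : ℝ) 1)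
    (hu : 0 ≤ u) : ∫ ω, expSummand a θ η u c (X ω) ∂P = Real.exp (logTerm a θ η (c * u)) := by
  set z := c * u with hz
  have hz0 : 0 ≤ z := by positivity
  have hau : a * u ≤ u := by nlinarith [ha.2]
  -- Since $\{T\le au\}\subseteq\{T\le u\}$, only three values occur, so the exponential is affine
  -- in the two indicators.
  have e : ∀ x, expSummand a θ η u c x = Real.exp (-((θ + η * a) * z ^ 2)) *
      ((Real.exp ((θ + η) * z) - Real.exp (θ * z)) *
        (Set.Iic (a * u)).indicator (fun _ => 1) x +
        (Real.exp (θ * z) - 1) * (Set.Iic u).indicator (fun _ => 1) x + 1) := by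
    intro x
    unfold expSummand
    by_cases h1 : x ≤ a * u
    · have h2 : x ≤ u := h1.trans hau
      simp only [Set.indicator_of_mem (show x ∈ Set.Iic (a * u) from h1),
        Set.indicator_of_mem (show x ∈ Set.Iic u from h2), mul_one]
      rw [sub_add_sub_cancel, sub_add_cancel, ← Real.exp_add]
      congr 1; rw [hz]; ring
    · by_cases h2 : x ≤ u
      · simp only [Set.indicator_of_notMem (show x ∉ Set.Iic (a * u) from h1),
          Set.indicator_of_mem (show x ∈ Set.Iic u from h2), mul_one, mul_zero, zero_add]
        rw [sub_add_cancel, ← Real.exp_add]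
        congr 1; rw [hz]; ring
      · simp only [Set.indicator_of_notMem (show x ∉ Set.Iic (a * u) from h1),
          Set.indicator_of_notMem (show x ∉ Set.Iic u from h2), mul_zero, zero_add, mul_one]
        congr 1; rw [hz]; ring
  simp only [e]
  have hi1 := integrable_indicator_Iic_comp (P := P) hX (a * u)
  have hi2 := integrable_indicator_Iic_comp (P := P) hX u
  have hi12 : Integrable (fun ω => (Real.exp ((θ + η) * z) - Real.exp (θ * z)) *
      (Set.Iic (a * u)).indicator (fun _ => (1 : ℝ)) (X ω) +
      (Real.exp (θ * z) - 1) * (Set.Iic u).indicator (fun _ => (1 : ℝ)) (X ω)) P :=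
    (hi1.const_mul _).add (hi2.const_mul _)
  rw [integral_const_mul, integral_add hi12 (integrable_const _), integral_add (hi1.const_mul _) (hi2.const_mul _), integral_const_mul,
    integral_const_mul, integral_indicator_Iic_comp hX hc hl (mul_nonneg ha.1 hu),
    integral_indicator_Iic_comp hX hc hl hu, integral_const, logTerm, Real.exp_sub,
    Real.exp_log (mgfTerm_pos ha hz0), Real.exp_neg, ← hz, mgfTerm,
    show c * (a * u) = a * z by rw [hz]; ring]
  simp only [probReal_univ, smul_eq_mul, mul_one]
  rw [div_eq_inv_mul]
  ring

end Exponential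

/-! ### The process, its exponential moments and probability bounds -/

/-- The standing assumptions on the clocks `(T_i)_{i ≥ 2}`: independent, and `T_i` exponential
with rate `c_i`. -/
structure IsClockFamily {Ω : Type*} [MeasurableSpace Ω] (P : Measure Ω) (τ : ℝ)
    (T : ℕ → Ω → ℝ) : Prop where
  measurable : ∀ i, 2 ≤ i → Measurable (T i)
  law : ∀ i, 2 ≤ i → P.map (T i) = expMeasure (coeffC τ i)
  indep : iIndepFun (fun i : {i : ℕ // 2 ≤ i} => T i) P

section Clocks

variable {Ω : Type*} [MeasurableSpace Ω] {P : Measure Ω} {τ β : ℝ} {T : ℕ → Ω → ℝ}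

lemma coeffC_pos (k : ℕ) : 0 < coeffC τ (k + 2) :=
  Real.rpow_pos_of_pos (by positivity) _

lemma summable_coeffC_cube (hτ : τ ∈ Set.Ioo (3 : ℝ) 4) :
    Summable fun k : ℕ => coeffC τ (k + 2) ^ 3 := by
  have hα2 : 1 / 3 < 1 / (τ - 1) := by
    apply one_div_lt_one_div_of_lt <;> linarith [hτ.1, hτ.2]
  have h := (Real.summable_nat_rpow (p := -(1 / (τ - 1)) * (3 : ℕ))).2 (by push_cast; linarith)
  refine ((summable_nat_add_iff 2).2 h).congr fun k => ?_
  exact (scaleZ_pow (τ := τ) (x := ((k + 2 : ℕ) : ℝ)) (by positivity) 3).symm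

lemma IsClockFamily.iIndepFun_add_two (hT : IsClockFamily P τ T) : iIndepFun (fun k : ℕ => T (k + 2)) P :=
  hT.indep.precomp (g := fun k : ℕ => (⟨k + 2, by omega⟩ : {i : ℕ // 2 ≤ i}))
    fun i j h => by simpa using h

omit [MeasurableSpace Ω] in
lemma thinnedLevyPartial_succ (n : ℕ) (t : ℝ) (ω : Ω) :
    thinnedLevyPartial τ β T (n + 1) t ω = 1 + β * t + ∑ k ∈ Finset.range n,
      coeffC τ (k + 2) * ((Set.Iic t).indicator (fun _ => 1) (T (k + 2) ω) -
        coeffC τ (k + 2) * t) := by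
  unfold thinnedLevyPartial
  congr 1
  rw [Finset.range_eq_Ico, Finset.sum_Ico_add' (fun i => coeffC τ i *
    ((Set.Iic t).indicator (fun _ => (1 : ℝ)) (T i ω) - coeffC τ i * t)) 0 n 2]
  rfl

lemma measurable_indicator_clock (hT : IsClockFamily P τ T) (k : ℕ) (t : ℝ) :
    Measurable fun ω => (Set.Iic t).indicator (fun _ => (1 : ℝ)) (T (k + 2) ω) :=
  (measurable_const.indicator measurableSet_Iic).comp (hT.measurable (k + 2) (by omega))

lemma measurable_thinnedLevyPartial (hT : IsClockFamily P τ T) (n : ℕ) (t : ℝ) :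
    Measurable (thinnedLevyPartial τ β T n t) := by
  cases n with
  | zero =>
    have : thinnedLevyPartial τ β T 0 t = fun _ => 1 + β * t := by
      ext ω; simp [thinnedLevyPartial]
    rw [this]; exact measurable_const
  | succ n =>
    rw [funext (thinnedLevyPartial_succ (τ := τ) (β := β) (T := T) n t)]
    refine measurable_const.add (Finset.measurable_sum _ fun k _ => ?_)
    exact ((measurable_indicator_clock hT k t).sub_const _).const_mul _

lemma measurable_thinnedLevy (hT : IsClockFamily P τ T) (t : ℝ) :
    Measurable (thinnedLevy τ β T t) :=
  (StronglyMeasurable.limUnder (l := atTop)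
    fun n => (measurable_thinnedLevyPartial (β := β) hT n t).stronglyMeasurable).measurable

lemma abs_one_sub_exp_neg_sub_le {x : ℝ} (hx : 0 ≤ x) : |1 - Real.exp (-x) - x| ≤ x ^ 2 := by
  have h1 := Real.add_one_le_exp (-x)
  rw [abs_le]
  refine ⟨?_, by nlinarith⟩
  rcases le_total x 1 with h | h
  · have := Real.abs_exp_sub_one_sub_id_le (x := -x) (by rwa [abs_neg, abs_of_nonneg hx])
    have := (abs_le.1 this).2
    nlinarith
  · have := Real.exp_le_one_iff.2 (show -x ≤ 0 by linarith)
    nlinarith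

/-- The series defining the thinned Lévy process converges almost surely. -/
lemma ae_tendsto_thinnedLevyPartial [IsProbabilityMeasure P] (hτ : τ ∈ Set.Ioo (3 : ℝ) 4)
    (hT : IsClockFamily P τ T) {t : ℝ} (ht : 0 ≤ t) :
    ∀ᵐ ω ∂P, Tendsto (fun n : ℕ => thinnedLevyPartial τ β T n t ω) atTop
      (𝓝 (thinnedLevy τ β T t ω)) := by
  let c : ℕ → ℝ := fun k => coeffC τ (k + 2)
  let p : ℕ → ℝ := fun k => 1 - Real.exp (-(c k * t))
  let I : ℕ → Ω → ℝ := fun k ω => (Set.Iic t).indicator (fun _ => (1 : ℝ)) (T (k + 2) ω)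
  -- Centre at the true mean $p_k$ instead of $c_kt$: the variances are at most $c_k^3t$, and the
  -- remaining deterministic terms $c_k(p_k-c_kt)$ at most $c_k^3t^2$ in absolute value. Both are
  -- summable.
  let Y : ℕ → Ω → ℝ := fun k ω => c k * (I k ω - p k)
  have hc : ∀ k, 0 < c k := coeffC_pos
  have hX : ∀ k, Measurable (T (k + 2)) := fun k => hT.measurable (k + 2) (by omega)
  have hl : ∀ k, P.map (T (k + 2)) = expMeasure (c k) := fun k => hT.law (k + 2) (by omega)
  have hIm : ∀ k, Measurable (I k) := fun k => measurable_indicator_clock hT k t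
  have hIi : ∀ k, Integrable (I k) P := fun k => integrable_indicator_Iic_comp (hX k) t
  have hI : ∀ k, ∫ ω, I k ω ∂P = p k := fun k => integral_indicator_Iic_comp (hX k) (hc k) (hl k) ht
  have hYm : ∀ k, Measurable (Y k) := fun k => ((hIm k).sub_const _).const_mul _
  have hp : ∀ k, 0 ≤ p k ∧ p k ≤ c k * t ∧ p k ≤ 1 := by
    intro k
    have h1 := Real.add_one_le_exp (-(c k * t))
    have h2 : Real.exp (-(c k * t)) ≤ 1 :=
      Real.exp_le_one_iff.2 (by have := mul_nonneg (hc k).le ht; linarith)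
    have h3 := Real.exp_pos (-(c k * t))
    refine ⟨?_, ?_, ?_⟩ <;> simp only [p] <;> linarith
  have hIsq : ∀ k ω, I k ω ^ 2 = I k ω := by
    intro k ω
    by_cases h : T (k + 2) ω ∈ Set.Iic t <;> simp [I, h]
  have hL : ∀ k, MemLp (Y k) 2 P := by
    intro k
    refine (MemLp.sub ?_ (memLp_const _)).const_mul _
    exact (memLp_const (1 : ℝ)).indicator (hX k measurableSet_Iic)
  have h0 : ∀ k, ∫ ω, Y k ω ∂P = 0 := by
    intro k
    simp only [Y]
    rw [integral_const_mul, integral_sub (hIi k) (integrable_const _), hI]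
    simp
  have hv : ∀ k, variance (Y k) P ≤ c k ^ 3 * t := by
    intro k
    have e : ∀ ω, Y k ω ^ 2 = c k ^ 2 * ((1 - 2 * p k) * I k ω + p k ^ 2) := by
      intro ω
      simp only [Y]
      linear_combination c k ^ 2 * hIsq k ω
    rw [variance_of_integral_eq_zero (hYm k).aemeasurable (h0 k)]
    simp only [e]
    rw [integral_const_mul, integral_add ((hIi k).const_mul _) (integrable_const _),
      integral_const_mul, hI]
    simp only [integral_const, probReal_univ, smul_eq_mul, one_mul]
    obtain ⟨h1, h2, h3⟩ := hp k
    calc c k ^ 2 * ((1 - 2 * p k) * p k + p k ^ 2) ≤ c k ^ 2 * (c k * t) := by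
          gcongr; nlinarith
      _ = _ := by ring
  have hcs : Summable fun k => c k ^ 3 := summable_coeffC_cube hτ
  have hind : iIndepFun Y P := (IsClockFamily.iIndepFun_add_two hT).comp
    (fun k x => c k * ((Set.Iic t).indicator (fun _ => (1 : ℝ)) x - p k))
    fun k => ((measurable_const.indicator measurableSet_Iic).sub_const _).const_mul _
  have hconv := ae_exists_tendsto_sum_of_summable_variance hYm hind hL h0
    (Summable.of_nonneg_of_le (fun _ => variance_nonneg _ _) hv (hcs.mul_right t))
  have hdet : Summable fun k => c k * (p k - c k * t) := by
    refine Summable.of_norm_bounded (hcs.mul_right (t ^ 2)) fun k => ?_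
    rw [Real.norm_eq_abs, abs_mul, abs_of_pos (hc k)]
    have := abs_one_sub_exp_neg_sub_le (mul_nonneg (hc k).le ht)
    calc c k * |p k - c k * t| ≤ c k * (c k * t) ^ 2 := by gcongr; exact (hc k).le
      _ = _ := by ring
  filter_upwards [hconv] with ω ⟨l, hlim⟩
  refine tendsto_nhds_limUnder ⟨1 + β * t + (l + ∑' k, c k * (p k - c k * t)), ?_⟩
  refine (tendsto_add_atTop_iff_nat 1).1 ?_
  refine ((hlim.add hdet.hasSum.tendsto_sum_nat).const_add (1 + β * t)).congr fun n => ?_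
  rw [thinnedLevyPartial_succ, ← Finset.sum_add_distrib]
  congr 1
  refine Finset.sum_congr rfl fun k _ => ?_
  simp only [Y, I, c]
  ring

/-- The exponent `θ u s + η u s'` evaluated at the truncations of `S_u` and `S_{a u}`. -/
noncomputable def partialExponent (τ β : ℝ) (T : ℕ → Ω → ℝ) (a θ η u : ℝ) (n : ℕ) (ω : Ω) : ℝ :=
  θ * u * thinnedLevyPartial τ β T n u ω + η * u * thinnedLevyPartial τ β T n (a * u) ω

/-- The contribution to the cumulant generating function of the deterministic part. -/
noncomputable def driftCgf (β a θ η u : ℝ) : ℝ := (θ + η) * u + β * (θ + η * a) * u ^ 2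

omit [MeasurableSpace Ω] in
lemma exp_partialExponent_succ (a θ η u : ℝ) (n : ℕ) (ω : Ω) :
    Real.exp (partialExponent τ β T a θ η u (n + 1) ω) = Real.exp (driftCgf β a θ η u) *
      ∏ k ∈ Finset.range n, expSummand a θ η u (coeffC τ (k + 2)) (T (k + 2) ω) := by
  simp only [expSummand]
  rw [← Real.exp_sum, ← Real.exp_add, Finset.sum_add_distrib, ← Finset.mul_sum, ← Finset.mul_sum,
    partialExponent, thinnedLevyPartial_succ, thinnedLevyPartial_succ, driftCgf]
  congr 1
  ring

lemma integral_exp_partialExponent_succ [IsProbabilityMeasure P] (hT : IsClockFamily P τ T)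
    {a θ η u : ℝ} (ha : a ∈ Set.Icc (0 : ℝ) 1) (hu : 0 ≤ u) (n : ℕ) :
    ∫ ω, Real.exp (partialExponent τ β T a θ η u (n + 1) ω) ∂P =
      Real.exp (driftCgf β a θ η u +
        ∑ k ∈ Finset.range n, logTerm a θ η (coeffC τ (k + 2) * u)) := by
  simp only [exp_partialExponent_succ]
  rw [integral_const_mul, Real.exp_add, Real.exp_sum]
  congr 1
  have hind : iIndepFun (fun k : Fin n => T ((k : ℕ) + 2)) P :=
    (IsClockFamily.iIndepFun_add_two hT).precomp Fin.val_injective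
  have h := hind.integral_fun_prod_comp
    (f := fun k : Fin n => expSummand a θ η u (coeffC τ ((k : ℕ) + 2)))
    (fun k => (hT.measurable _ (by omega)).aemeasurable)
    (fun k => (measurable_expSummand _ _ _ _ _).aestronglyMeasurable)
  simp only [Finset.prod_range]
  rw [h]
  exact Finset.prod_congr rfl fun k _ =>
    integral_expSummand (hT.measurable _ (by omega)) (coeffC_pos _) (hT.law _ (by omega)) ha hu

/-- A non-integrable function has Bochner integral $0$, but the value computed above is positive. -/
lemma integrable_exp_partialExponent_succ [IsProbabilityMeasure P] (hT : IsClockFamily P τ T)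
    {a θ η u : ℝ} (ha : a ∈ Set.Icc (0 : ℝ) 1) (hu : 0 ≤ u) (n : ℕ) :
    Integrable (fun ω => Real.exp (partialExponent τ β T a θ η u (n + 1) ω)) P := by
  by_contra h
  have := integral_exp_partialExponent_succ (β := β) (θ := θ) (η := η) hT ha hu n
  rw [integral_undef h] at this
  exact (Real.exp_pos _).ne this

/-- The cumulant generating function of `(u S_u, u S_{a u})`. -/
noncomputable def levyCgf (τ β a θ η u : ℝ) : ℝ :=
  driftCgf β a θ η u + ∑' k : ℕ, logTerm a θ η (coeffC τ (k + 2) * u)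

lemma coeffC_mul_eq_scaleZ (hτ : τ ∈ Set.Ioo (3 : ℝ) 4) {u : ℝ} (hu : 0 < u) (k : ℕ) :
    coeffC τ (k + 2) * u = scaleZ τ ((k + 2 : ℕ) / u ^ (τ - 1)) := by
  have h1 : 0 < τ - 1 := by linarith [hτ.1]
  rw [scaleZ, Real.div_rpow (by positivity) (by positivity), ← Real.rpow_mul hu.le,
    mul_neg, mul_one_div_cancel h1.ne', Real.rpow_neg_one, div_inv_eq_mul]
  rfl

lemma antitoneOn_logTerm_bound (hτ : τ ∈ Set.Ioo (3 : ℝ) 4) (R : ℝ) (hR : 0 ≤ R) :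
    AntitoneOn (fun x => 2 * R * termConst R * domFun τ x) (Set.Ioi 0) := by
  have := one_le_termConst hR
  intro x hx y hy hxy
  exact mul_le_mul_of_nonneg_left (antitoneOn_domFun hτ hx hy hxy) (by positivity)

lemma summable_logTerm (hτ : τ ∈ Set.Ioo (3 : ℝ) 4) {a θ η u : ℝ} (ha : a ∈ Set.Icc (0 : ℝ) 1)
    (hu : 0 < u) : Summable fun k : ℕ => logTerm a θ η (coeffC τ (k + 2) * u) := by
  have hN : 0 < u ^ (τ - 1) := Real.rpow_pos_of_pos hu _
  have h := (hasSum_riemannCell (G := fun x => logTerm a θ η (scaleZ τ x))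
    (fun x hx => abs_logTerm_scaleZ_le ha hx)
    (antitoneOn_logTerm_bound hτ (|θ| + |η|) (by positivity))
    ((integrableOn_domFun hτ).const_mul _) hN).summable
  rw [summable_mul_left_iff (inv_ne_zero hN.ne')] at h
  simpa only [coeffC_mul_eq_scaleZ hτ hu] using h

lemma tendsto_levyCgf_div (hτ : τ ∈ Set.Ioo (3 : ℝ) 4) {a θ η : ℝ} (ha : a ∈ Set.Icc (0 : ℝ) 1) :
    Tendsto (fun u => levyCgf τ β a θ η u / u ^ (τ - 1)) atTop (𝓝 (limitCgf τ a θ η)) := by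
  have hN : Tendsto (fun u : ℝ => u ^ (τ - 1)) atTop atTop :=
    tendsto_rpow_atTop (by linarith [hτ.1])
  have h1 := (tendsto_riemannSum (continuousOn_logTerm_scaleZ (τ := τ) (θ := θ) (η := η) ha)
    (fun x hx => abs_logTerm_scaleZ_le ha hx)
    (antitoneOn_logTerm_bound hτ (|θ| + |η|) (by positivity))
    ((integrableOn_domFun hτ).const_mul _)).comp hN
  have h2 : Tendsto (fun u : ℝ => (θ + η) * u ^ (-(τ - 2)) +
      β * (θ + η * a) * u ^ (-(τ - 3))) atTop (𝓝 ((θ + η) * 0 + β * (θ + η * a) * 0)) :=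
    ((tendsto_rpow_neg_atTop (by linarith [hτ.1])).const_mul _).add
      ((tendsto_rpow_neg_atTop (by linarith [hτ.1])).const_mul _)
  have h3 := h2.add h1
  simp only [mul_zero, zero_add] at h3
  refine h3.congr' ?_
  filter_upwards [eventually_gt_atTop 0] with u hu
  have hN0 : 0 < u ^ (τ - 1) := Real.rpow_pos_of_pos hu _
  have e1 : u ^ (-(τ - 2)) = u / u ^ (τ - 1) := by
    rw [show -(τ - 2) = 1 - (τ - 1) by ring, Real.rpow_sub hu, Real.rpow_one]
  have e2 : u ^ (-(τ - 3)) = u ^ 2 / u ^ (τ - 1) := by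
    rw [show -(τ - 3) = 2 - (τ - 1) by ring, Real.rpow_sub hu, Real.rpow_two]
  simp only [Function.comp_apply, levyCgf, driftCgf, coeffC_mul_eq_scaleZ hτ hu, e1, e2]
  field_simp

/-- Upper bound for the joint exponential moment of the limiting process. -/
lemma lintegral_exp_thinnedLevy_le [IsProbabilityMeasure P] (hτ : τ ∈ Set.Ioo (3 : ℝ) 4)
    (hT : IsClockFamily P τ T) {a u : ℝ} (θ η : ℝ) (ha : a ∈ Set.Icc (0 : ℝ) 1) (hu : 0 < u) :
    ∫⁻ ω, ENNReal.ofReal (Real.exp (θ * u * thinnedLevy τ β T u ω +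
      η * u * thinnedLevy τ β T (a * u) ω)) ∂P ≤ ENNReal.ofReal (Real.exp (levyCgf τ β a θ η u)) := by
  have hlim : ∀ᵐ ω ∂P, Tendsto (fun n => ENNReal.ofReal
      (Real.exp (partialExponent τ β T a θ η u (n + 1) ω))) atTop
      (𝓝 (ENNReal.ofReal (Real.exp (θ * u * thinnedLevy τ β T u ω +
        η * u * thinnedLevy τ β T (a * u) ω)))) := by
    filter_upwards [ae_tendsto_thinnedLevyPartial (β := β) hτ hT hu.le,
      ae_tendsto_thinnedLevyPartial (β := β) hτ hT (mul_nonneg ha.1 hu.le)] with ω h1 h2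
    refine ENNReal.tendsto_ofReal ((Real.continuous_exp.tendsto _).comp ?_)
    exact ((h1.const_mul _).add (h2.const_mul _)).comp (tendsto_add_atTop_nat 1)
  have hsum := (summable_logTerm (θ := θ) (η := η) hτ ha hu).hasSum.tendsto_sum_nat
  calc _ = ∫⁻ ω, liminf (fun n => ENNReal.ofReal
        (Real.exp (partialExponent τ β T a θ η u (n + 1) ω))) atTop ∂P :=
        lintegral_congr_ae (hlim.mono fun ω h => h.liminf_eq.symm)
    -- Fatou gives only an inequality, which suffices since this feeds upper bounds alone.
    _ ≤ liminf (fun n => ∫⁻ ω, ENNReal.ofReal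
        (Real.exp (partialExponent τ β T a θ η u (n + 1) ω)) ∂P) atTop := by
        refine lintegral_liminf_le fun n => ENNReal.measurable_ofReal.comp (Real.measurable_exp.comp ?_)
        exact ((measurable_thinnedLevyPartial hT _ _).const_mul _).add
          ((measurable_thinnedLevyPartial hT _ _).const_mul _)
    _ = ENNReal.ofReal (Real.exp (levyCgf τ β a θ η u)) := by
        refine Tendsto.liminf_eq ?_
        have e : ∀ n, ∫⁻ ω, ENNReal.ofReal
            (Real.exp (partialExponent τ β T a θ η u (n + 1) ω)) ∂P = ENNReal.ofReal
            (Real.exp (driftCgf β a θ η u +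
              ∑ k ∈ Finset.range n, logTerm a θ η (coeffC τ (k + 2) * u))) := by
          intro n
          rw [← ofReal_integral_eq_lintegral_ofReal
            (integrable_exp_partialExponent_succ hT ha hu.le n)
            (Eventually.of_forall fun ω => (Real.exp_pos _).le),
            integral_exp_partialExponent_succ hT ha hu.le n]
        simp only [e]
        exact ENNReal.tendsto_ofReal ((Real.continuous_exp.tendsto _).comp (hsum.const_add _))

/-- Exponential Chebyshev bound for the limiting process. -/
lemma measureReal_thinnedLevy_le [IsProbabilityMeasure P] (hτ : τ ∈ Set.Ioo (3 : ℝ) 4)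
    (hT : IsClockFamily P τ T) {a u θ η b : ℝ} (ha : a ∈ Set.Icc (0 : ℝ) 1) (hu : 0 < u)
    {A : Set Ω} (hA : ∀ ω ∈ A, b ≤ θ * u * thinnedLevy τ β T u ω +
      η * u * thinnedLevy τ β T (a * u) ω) :
    P.real A ≤ Real.exp (levyCgf τ β a θ η u - b) := by
  have h1 : ENNReal.ofReal (Real.exp b) * P A ≤
      ENNReal.ofReal (Real.exp (levyCgf τ β a θ η u)) := by
    refine le_trans ?_ (lintegral_exp_thinnedLevy_le (β := β) hτ hT θ η ha hu)
    refine le_trans ?_ (mul_meas_ge_le_lintegral (Measurable.ennreal_ofReal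
      (Real.measurable_exp.comp (((measurable_thinnedLevy hT _).const_mul _).add
        ((measurable_thinnedLevy hT _).const_mul _)))) (ENNReal.ofReal (Real.exp b)))
    gcongr
    intro ω hω
    exact ENNReal.ofReal_le_ofReal (Real.exp_le_exp.2 (hA ω hω))
  have h2 := ENNReal.toReal_mono ENNReal.ofReal_ne_top h1
  rw [ENNReal.toReal_mul, ENNReal.toReal_ofReal (Real.exp_pos _).le,
    ENNReal.toReal_ofReal (Real.exp_pos _).le] at h2
  rw [Real.exp_sub, le_div_iff₀ (Real.exp_pos _), mul_comm]
  exact h2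

/-- Three regimes: for $y<1$ a lower tilt dominates, for $y>K$ a higher one, and for $1\le y\le K$
the indicator term does. -/
lemma exp_mul_le_indicator_add {θ δ K y : ℝ} (hθ : 0 ≤ θ) (hδ : 0 ≤ δ) :
    Real.exp (θ * y) ≤ Real.exp (θ * K) * (Set.Ici 1).indicator (fun _ => 1) y +
      Real.exp δ * Real.exp ((θ - δ) * y) + Real.exp (-(δ * K)) * Real.exp ((θ + δ) * y) := by
  rw [← Real.exp_add, ← Real.exp_add]
  have p1 := Real.exp_pos (δ + (θ - δ) * y)
  have p2 := Real.exp_pos (-(δ * K) + (θ + δ) * y)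
  have p3 := Real.exp_pos (θ * K)
  have p4 : 0 ≤ (Set.Ici (1 : ℝ)).indicator (fun _ => (1 : ℝ)) y :=
    Set.indicator_nonneg (fun _ _ => zero_le_one) _
  have p5 := mul_nonneg p3.le p4
  rcases lt_or_ge y 1 with h | h
  · have : Real.exp (θ * y) ≤ Real.exp (δ + (θ - δ) * y) := Real.exp_le_exp.2 (by nlinarith)
    linarith
  · rcases lt_or_ge K y with hK | hK
    · have : Real.exp (θ * y) ≤ Real.exp (-(δ * K) + (θ + δ) * y) :=
        Real.exp_le_exp.2 (by nlinarith)
      linarith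
    · have : Real.exp (θ * y) ≤ Real.exp (θ * K) := Real.exp_le_exp.2 (by nlinarith)
      rw [Set.indicator_of_mem (show y ∈ Set.Ici 1 from h)]
      linarith

/-- Lower bound for the survival probability in terms of the cumulant generating function at three
points. -/
lemma exp_levyCgf_le [IsProbabilityMeasure P] (hτ : τ ∈ Set.Ioo (3 : ℝ) 4)
    (hT : IsClockFamily P τ T) {u θ δ K : ℝ} (hu : 0 < u) (hθ : 0 ≤ θ) (hδ : 0 ≤ δ) :
    Real.exp (levyCgf τ β 1 θ 0 u) ≤ Real.exp (θ * K) * P.real {ω | 0 < thinnedLevy τ β T u ω} +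
      Real.exp δ * Real.exp (levyCgf τ β 1 (θ - δ) 0 u) +
      Real.exp (-(δ * K)) * Real.exp (levyCgf τ β 1 (θ + δ) 0 u) := by
  have h11 : (1 : ℝ) ∈ Set.Icc (0 : ℝ) 1 := ⟨zero_le_one, le_rfl⟩
  let Y : ℕ → Ω → ℝ := fun n ω => u * thinnedLevyPartial τ β T (n + 1) u ω
  let Z : Ω → ℝ := fun ω => u * thinnedLevy τ β T u ω
  have hYm : ∀ n, Measurable (Y n) := fun n => (measurable_thinnedLevyPartial hT _ _).const_mul _
  have hYZ : TendstoInMeasure P Y atTop Z := by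
    refine tendstoInMeasure_of_tendsto_ae (fun n => (hYm n).aestronglyMeasurable) ?_
    filter_upwards [ae_tendsto_thinnedLevyPartial (β := β) hτ hT hu.le] with ω h
    exact (h.const_mul u).comp (tendsto_add_atTop_nat 1)
  have hprob : Tendsto (fun n => P.real {ω | 1 ≤ dist (Y n ω) (Z ω)}) atTop (𝓝 0) := by
    have := (tendstoInMeasure_iff_dist.1 hYZ) 1 one_pos
    exact (ENNReal.tendsto_toReal ENNReal.zero_ne_top).comp this
  have hexp : ∀ s : ℝ, ∀ n ω, Real.exp (s * Y n ω) =
      Real.exp (partialExponent τ β T 1 s 0 u (n + 1) ω) := by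
    intro s n ω; simp only [partialExponent, Y]; congr 1; ring
  have hint : ∀ s : ℝ, ∀ n, Integrable (fun ω => Real.exp (s * Y n ω)) P := by
    intro s n; simp only [hexp]; exact integrable_exp_partialExponent_succ hT h11 hu.le n
  have hlim : ∀ s : ℝ, Tendsto (fun n => ∫ ω, Real.exp (s * Y n ω) ∂P) atTop
      (𝓝 (Real.exp (levyCgf τ β 1 s 0 u))) := by
    intro s
    simp only [hexp, integral_exp_partialExponent_succ hT h11 hu.le]
    exact (Real.continuous_exp.tendsto _).comp
      ((summable_logTerm hτ h11 hu).hasSum.tendsto_sum_nat.const_add _)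
  have hle : ∀ n, ∫ ω, Real.exp (θ * Y n ω) ∂P ≤
      Real.exp (θ * K) * (P.real {ω | 0 < thinnedLevy τ β T u ω} +
        P.real {ω | 1 ≤ dist (Y n ω) (Z ω)}) +
      Real.exp δ * ∫ ω, Real.exp ((θ - δ) * Y n ω) ∂P +
      Real.exp (-(δ * K)) * ∫ ω, Real.exp ((θ + δ) * Y n ω) ∂P := by
    intro n
    have hS : MeasurableSet {ω | 1 ≤ Y n ω} := measurableSet_le measurable_const (hYm n)
    have hI : ∫ ω, (Set.Ici (1 : ℝ)).indicator (fun _ => (1 : ℝ)) (Y n ω) ∂P =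
        P.real {ω | 1 ≤ Y n ω} := integral_indicator_one hS
    have hIi : Integrable (fun ω => (Set.Ici (1 : ℝ)).indicator (fun _ => (1 : ℝ)) (Y n ω)) P :=
      (integrable_const (1 : ℝ)).indicator hS
    have hi1 : Integrable (fun ω => Real.exp (θ * K) *
        (Set.Ici (1 : ℝ)).indicator (fun _ => (1 : ℝ)) (Y n ω) +
        Real.exp δ * Real.exp ((θ - δ) * Y n ω)) P :=
      (hIi.const_mul _).add ((hint _ n).const_mul _)
    have hm := integral_mono (hint θ n) (hi1.add ((hint (θ + δ) n).const_mul
      (Real.exp (-(δ * K))))) fun ω => exp_mul_le_indicator_add (K := K) (y := Y n ω) hθ hδ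
    simp only [Pi.add_apply] at hm
    rw [integral_add hi1 ((hint _ n).const_mul _), integral_add (hIi.const_mul _)
      ((hint _ n).const_mul _), integral_const_mul, integral_const_mul, integral_const_mul, hI] at hm
    refine hm.trans ?_
    gcongr
    -- The threshold $1$ leaves a margin: a truncation at least $1$ whose limit is nonpositive is at
    -- distance at least $1$ from it, which has vanishing probability. Working with truncations
    -- keeps the moments exact.
    refine (measureReal_mono (fun ω hω => ?_)).trans (measureReal_union_le _ _)
    rw [Set.mem_union]
    by_contra! hcon
    obtain ⟨h1, h2⟩ := hcon
    simp only [Set.mem_ofPred_eq, not_lt, not_le, Real.dist_eq] at h1 h2 hω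
    have h3 : Z ω ≤ 0 := mul_nonpos_of_nonneg_of_nonpos hu.le h1
    have := le_abs_self (Y n ω - Z ω)
    linarith
  have hR := (((hprob.const_add (P.real {ω | 0 < thinnedLevy τ β T u ω})).const_mul
    (Real.exp (θ * K))).add ((hlim (θ - δ)).const_mul (Real.exp δ))).add
    ((hlim (θ + δ)).const_mul (Real.exp (-(δ * K))))
  rw [add_zero] at hR
  exact le_of_tendsto_of_tendsto' (hlim θ) hR hle

end Clocks

/-! ### Large deviation bounds and conditional concentration -/

section Concentration

variable {Ω : Type*} [MeasurableSpace Ω] {P : Measure Ω} {τ β : ℝ} {T : ℕ → Ω → ℝ}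

lemma tendsto_exp_of_tendsto_div {f N : ℝ → ℝ} {l : ℝ} (hN : Tendsto N atTop atTop)
    (hf : Tendsto (fun u => f u / N u) atTop (𝓝 l)) (hl : l < 0) :
    Tendsto (fun u => Real.exp (f u)) atTop (𝓝 0) := by
  refine Real.tendsto_exp_atBot.comp ((hf.neg_mul_atTop hl hN).congr' ?_)
  filter_upwards [hN.eventually_gt_atTop 0] with u hu
  field_simp

/-- The slope vanishes at $\theta^*$, so the rise from $\theta^*$ to $\theta^*+2\delta$ is at most
$2\delta\cdot k/4$; the value at $\theta^*+\delta$ exceeds the minimum. -/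
lemma exists_limitCgf_step (hτ : τ ∈ Set.Ioo (3 : ℝ) 4) {k : ℝ} (hk : 0 < k) :
    ∃ δ, 0 < δ ∧ δ < k ∧
      limitCgf τ 1 0 (thetaStar τ + δ + δ) - limitCgf τ 1 0 (thetaStar τ + δ) < δ * k := by
  obtain ⟨-, hs⟩ := thetaStar_spec hτ
  have hd := hasDerivAt_limitCgf (θ := 0) (η := thetaStar τ) hτ ⟨zero_le_one, le_refl (1 : ℝ)⟩
  rw [hs, hasDerivAt_iff_isLittleO_nhds_zero, Asymptotics.isLittleO_iff] at hd
  obtain ⟨r, hr, hball⟩ := Metric.eventually_nhds_iff.1 (hd (show 0 < k / 4 by positivity))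
  set δ := min (k / 2) (r / 4)
  have hδ : 0 < δ := lt_min (by positivity) (by positivity)
  have hδk : δ ≤ k / 2 := min_le_left _ _
  have hδr : δ ≤ r / 4 := min_le_right _ _
  refine ⟨δ, hδ, by linarith, ?_⟩
  have h := hball (y := 2 * δ) (by
    rw [Real.dist_eq, sub_zero, abs_of_pos (by positivity)]; linarith)
  simp only [smul_zero, sub_zero, Real.norm_eq_abs] at h
  rw [abs_of_pos (show 0 < 2 * δ by positivity), two_mul, ← add_assoc] at h
  have h1 := limitCgf_lt_of_limitSlope_eq_zero hτ hs
    (show thetaStar τ + δ ≠ thetaStar τ by simpa using hδ.ne')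
  have h2 := (abs_le.1 h).2
  have : 0 < δ * k := by positivity
  linarith

/-- Large deviation lower bound for the survival probability. -/
lemma eventually_exp_le_measureReal_pos [IsProbabilityMeasure P] (hτ : τ ∈ Set.Ioo (3 : ℝ) 4)
    (hT : IsClockFamily P τ T) {ρ : ℝ} (hρ : 0 < ρ) :
    ∀ᶠ u : ℝ in atTop, Real.exp (u ^ (τ - 1) * (limitCgf τ 1 0 (thetaStar τ) - ρ)) ≤
      P.real {ω | 0 < thinnedLevy τ β T u ω} := by
  obtain ⟨hpos, hs⟩ := thetaStar_spec hτ
  set θs := thetaStar τ with hθs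
  have hN : Tendsto (fun u : ℝ => u ^ (τ - 1)) atTop atTop :=
    tendsto_rpow_atTop (by linarith [hτ.1])
  set k := min 1 (ρ / (2 * (θs + 1))) with hkdef
  have hk : 0 < k := lt_min one_pos (by positivity)
  have hk1 : k ≤ 1 := min_le_left _ _
  have hk2 : (θs + 1) * k ≤ ρ / 2 := by
    have : k ≤ ρ / (2 * (θs + 1)) := min_le_right _ _
    rw [le_div_iff₀ (by positivity)] at this
    linarith
  obtain ⟨δ, hδ, hδk, hstep⟩ := exists_limitCgf_step hτ hk
  rw [← hθs] at hstep
  -- Tilting above $\theta^*$ makes $\theta-\delta=\theta^*$ strictly cheaper than $\theta$, so the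
  -- part $uS_u<1$ is negligible (`t1`). `hstep` handles the part above $K=ku^{\tau-1}$ (`t2`). Half
  -- of the moment remains, hence the $\log 2$ in `t3`, and $\theta k\le\rho/2$ absorbs the factor
  -- $e^{\theta K}$.
  set θ := θs + δ with hθ
  have hlt : limitCgf τ 1 0 θs < limitCgf τ 1 0 θ :=
    limitCgf_lt_of_limitSlope_eq_zero hτ hs (by rw [hθ]; simpa using hδ.ne')
  have hΨ : ∀ s : ℝ, Tendsto (fun u => levyCgf τ β 1 s 0 u / u ^ (τ - 1)) atTop
      (𝓝 (limitCgf τ 1 0 s)) := by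
    intro s
    have := tendsto_levyCgf_div (β := β) (θ := s) (η := 0) hτ ⟨zero_le_one, le_refl (1 : ℝ)⟩
    rwa [limitCgf_right_zero] at this
  have hc : ∀ b : ℝ, Tendsto (fun u : ℝ => b / u ^ (τ - 1)) atTop (𝓝 0) :=
    fun b => tendsto_const_nhds.div_atTop hN
  have hNN : Tendsto (fun u : ℝ => u ^ (τ - 1) / u ^ (τ - 1)) atTop (𝓝 1) :=
    tendsto_const_nhds.congr' (by
      filter_upwards [hN.eventually_gt_atTop 0] with u hu using (div_self hu.ne').symm)
  have t1 : Tendsto (fun u => Real.exp (δ + levyCgf τ β 1 (θ - δ) 0 u - levyCgf τ β 1 θ 0 u))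
      atTop (𝓝 0) := by
    refine tendsto_exp_of_tendsto_div (l := 0 + limitCgf τ 1 0 (θ - δ) - limitCgf τ 1 0 θ) hN ?_ ?_
    · simp only [sub_div, add_div]
      exact ((hc δ).add (hΨ _)).sub (hΨ _)
    · rw [show θ - δ = θs by rw [hθ]; ring]; linarith
  have t2 : Tendsto (fun u => Real.exp (-(δ * (k * u ^ (τ - 1))) + levyCgf τ β 1 (θ + δ) 0 u -
      levyCgf τ β 1 θ 0 u)) atTop (𝓝 0) := by
    refine tendsto_exp_of_tendsto_div
      (l := -(δ * k) * 1 + limitCgf τ 1 0 (θ + δ) - limitCgf τ 1 0 θ) hN ?_ (by linarith)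
    have := ((hNN.const_mul (-(δ * k))).add (hΨ (θ + δ))).sub (hΨ θ)
    refine this.congr fun u => ?_
    ring
  have t3 : Tendsto (fun u => Real.exp (Real.log 2 + θ * (k * u ^ (τ - 1)) +
      u ^ (τ - 1) * (limitCgf τ 1 0 θs - ρ) - levyCgf τ β 1 θ 0 u)) atTop (𝓝 0) := by
    refine tendsto_exp_of_tendsto_div
      (l := 0 + θ * k * 1 + 1 * (limitCgf τ 1 0 θs - ρ) - limitCgf τ 1 0 θ) hN ?_ ?_
    · refine ((((hc (Real.log 2)).add (hNN.const_mul (θ * k))).add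
        (hNN.mul_const (limitCgf τ 1 0 θs - ρ))).sub (hΨ θ)).congr fun u => ?_
      ring
    · have : θ * k ≤ (θs + 1) * k := by gcongr; rw [hθ]; linarith
      linarith
  filter_upwards [t1.eventually (gt_mem_nhds (show (0 : ℝ) < 1 / 4 by norm_num)),
    t2.eventually (gt_mem_nhds (show (0 : ℝ) < 1 / 4 by norm_num)),
    t3.eventually (gt_mem_nhds one_pos), eventually_gt_atTop 0] with u h1 h2 h3 hu
  have hmain := exp_levyCgf_le (β := β) (K := k * u ^ (τ - 1)) hτ hT hu
    (show 0 ≤ θ by rw [hθ]; positivity) hδ.le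
  have hE := Real.exp_pos (levyCgf τ β 1 θ 0 u)
  rw [Real.exp_sub, div_lt_iff₀ hE, Real.exp_add] at h1 h2
  rw [Real.exp_sub, div_lt_one hE, Real.exp_add, Real.exp_add, Real.exp_log two_pos] at h3
  have hθK := Real.exp_pos (θ * (k * u ^ (τ - 1)))
  refine le_of_mul_le_mul_left ?_ hθK
  linarith

/-- Large deviation upper bound for survival together with an atypical value of `S_{a u}` in the
direction `s = ± 1`. -/
lemma exists_eventually_measureReal_le [IsProbabilityMeasure P] (hτ : τ ∈ Set.Ioo (3 : ℝ) 4)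
    (hT : IsClockFamily P τ T) {a ε s : ℝ} (ha : a ∈ Set.Icc (0 : ℝ) 1) (hε : 0 < ε)
    (hs : |s| = 1) :
    ∃ c, 0 < c ∧ ∀ᶠ u : ℝ in atTop, P.real {ω | 0 < thinnedLevy τ β T u ω ∧
      ε * u ^ (τ - 2) ≤ s * (thinnedLevy τ β T (a * u) ω - u ^ (τ - 2) * rateIE τ a)} ≤
      Real.exp (u ^ (τ - 1) * (limitCgf τ 1 0 (thetaStar τ) - c)) := by
  obtain ⟨hpos, -⟩ := thetaStar_spec hτ
  have hd := hasDerivAt_limitCgf (θ := thetaStar τ) (η := 0) hτ ha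
  rw [← rateIE_eq hτ, hasDerivAt_iff_isLittleO_nhds_zero, Asymptotics.isLittleO_iff] at hd
  obtain ⟨r, hr, hball⟩ := Metric.eventually_nhds_iff.1 (hd (show 0 < ε / 2 by positivity))
  set h := r / 2 with hh
  have hh0 : 0 < h := by positivity
  have habs : |h * s| = h := by rw [abs_mul, hs, mul_one, abs_of_pos hh0]
  have hdev := hball (y := h * s) (by rw [Real.dist_eq, sub_zero, habs]; linarith)
  simp only [zero_add, smul_eq_mul, Real.norm_eq_abs, habs] at hdev
  rw [limitCgf_right_zero] at hdev
  have hdev' := (abs_le.1 hdev).2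
  -- Chebyshev gains $h\varepsilon$, the linearization error costs at most $h\varepsilon/2$, and a
  -- quarter is left as slack for the convergence in $u$.
  refine ⟨ε * h / 4, by positivity, ?_⟩
  set I := rateIE τ a
  have hN : Tendsto (fun u : ℝ => u ^ (τ - 1)) atTop atTop :=
    tendsto_rpow_atTop (by linarith [hτ.1])
  have hΨ := tendsto_levyCgf_div (β := β) (θ := thetaStar τ) (η := h * s) hτ ha
  have hlt : limitCgf τ a (thetaStar τ) (h * s) <
      limitCgf τ 1 0 (thetaStar τ) - ε * h / 4 + h * (ε + s * I) := by
    have : 0 < ε * h := by positivity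
    linarith
  filter_upwards [hΨ.eventually (gt_mem_nhds hlt), eventually_gt_atTop 0] with u h1 hu
  have hN0 : 0 < u ^ (τ - 1) := Real.rpow_pos_of_pos hu _
  have hpow : u * u ^ (τ - 2) = u ^ (τ - 1) := by
    rw [show τ - 1 = 1 + (τ - 2) by ring, Real.rpow_add hu, Real.rpow_one]
  rw [div_lt_iff₀ hN0] at h1
  refine (measureReal_thinnedLevy_le (β := β) (θ := thetaStar τ) (η := h * s)
    (b := u ^ (τ - 1) * (h * (ε + s * I))) hτ hT ha hu ?_).trans
    (Real.exp_le_exp.2 (by linarith))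
  rintro ω ⟨hω1, hω2⟩
  have e1 : 0 ≤ thetaStar τ * u * thinnedLevy τ β T u ω := by positivity
  have e2 := mul_le_mul_of_nonneg_left hω2 (show 0 ≤ h * u by positivity)
  rw [← hpow]
  linarith

lemma cond_real_compl_le [IsProbabilityMeasure P] {A B C D : Set Ω} (hA : MeasurableSet A)
    (h : A ∩ Bᶜ ⊆ C ∪ D) : (cond P A).real Bᶜ ≤ (P.real C + P.real D) / P.real A := by
  rw [Measure.real, cond_apply hA, ENNReal.toReal_mul, ENNReal.toReal_inv, ← Measure.real,
    ← Measure.real, inv_mul_eq_div]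
  gcongr
  exact (measureReal_mono h).trans (measureReal_union_le _ _)

/-- Conditionally on survival up to time `u`, the rescaled process concentrates. -/
lemma tendsto_cond_thinnedLevy [IsProbabilityMeasure P] (hτ : τ ∈ Set.Ioo (3 : ℝ) 4)
    (hT : IsClockFamily P τ T) {a ε : ℝ} (ha : a ∈ Set.Icc (0 : ℝ) 1) (hε : 0 < ε) :
    Tendsto (fun u : ℝ => cond P {ω | 0 < thinnedLevy τ β T u ω}
      {ω | |thinnedLevy τ β T (a * u) ω - u ^ (τ - 2) * rateIE τ a| ≤ ε * u ^ (τ - 2)})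
      atTop (𝓝 1) := by
  obtain ⟨c₁, hc₁, h₁⟩ := exists_eventually_measureReal_le (β := β) hτ hT ha hε
    (show |(1 : ℝ)| = 1 by simp)
  obtain ⟨c₂, hc₂, h₂⟩ := exists_eventually_measureReal_le (β := β) hτ hT ha hε
    (show |(-1 : ℝ)| = 1 by simp)
  set c := min c₁ c₂
  have hc : 0 < c := lt_min hc₁ hc₂
  -- Giving up only $c/2$ in the survival bound leaves a net decay $e^{-(c/2)u^{\tau-1}}$ for each
  -- direction of deviation.
  have h₀ := eventually_exp_le_measureReal_pos (β := β) hτ hT (show 0 < c / 2 by positivity)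
  have hN : Tendsto (fun u : ℝ => u ^ (τ - 1)) atTop atTop :=
    tendsto_rpow_atTop (by linarith [hτ.1])
  set A : ℝ → Set Ω := fun u => {ω | 0 < thinnedLevy τ β T u ω}
  set B : ℝ → Set Ω := fun u =>
    {ω | |thinnedLevy τ β T (a * u) ω - u ^ (τ - 2) * rateIE τ a| ≤ ε * u ^ (τ - 2)}
  have hA : ∀ u, MeasurableSet (A u) := fun u =>
    measurableSet_lt measurable_const (measurable_thinnedLevy hT u)
  have hB : ∀ u, MeasurableSet (B u) := fun u =>
    measurableSet_le ((measurable_thinnedLevy hT _).sub_const _).abs measurable_const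
  have hbound : ∀ᶠ u in atTop, (cond P (A u)).real (B u)ᶜ ≤
      2 * Real.exp (-(c / 2) * u ^ (τ - 1)) ∧ 0 < P.real (A u) := by
    filter_upwards [h₀, h₁, h₂, hN.eventually_gt_atTop 0] with u g0 g1 g2 hN0
    have hAp : 0 < P.real (A u) := (Real.exp_pos _).trans_le g0
    refine ⟨(cond_real_compl_le (hA u) (fun ω hω => ?_)).trans
      ((div_le_div_of_nonneg_right (add_le_add g1 g2) hAp.le).trans ?_), hAp⟩
    · have h3 : ε * u ^ (τ - 2) < |thinnedLevy τ β T (a * u) ω - u ^ (τ - 2) * rateIE τ a| :=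
        not_le.1 hω.2
      rcases lt_abs.1 h3 with h4 | h4
      · exact Or.inl ⟨hω.1, by linarith⟩
      · exact Or.inr ⟨hω.1, by linarith⟩
    · rw [div_le_iff₀ hAp]
      set L := limitCgf τ 1 0 (thetaStar τ)
      have hexp : ∀ c', c ≤ c' → Real.exp (u ^ (τ - 1) * (L - c')) ≤
          Real.exp (-(c / 2) * u ^ (τ - 1)) * P.real (A u) := by
        intro c' hc'
        refine le_trans ?_ (mul_le_mul_of_nonneg_left g0 (Real.exp_pos _).le)
        rw [← Real.exp_add]
        apply Real.exp_le_exp.2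
        nlinarith
      linarith [hexp c₁ (min_le_left _ _), hexp c₂ (min_le_right _ _)]
  have hzero : Tendsto (fun u : ℝ => 2 * Real.exp (-(c / 2) * u ^ (τ - 1))) atTop (𝓝 0) := by
    have : Tendsto (fun u : ℝ => -(c / 2) * u ^ (τ - 1)) atTop atBot :=
      hN.const_mul_atTop_of_neg (by linarith)
    simpa using (Real.tendsto_exp_atBot.comp this).const_mul 2
  have hcompl : Tendsto (fun u => (cond P (A u)).real (B u)ᶜ) atTop (𝓝 0) :=
    squeeze_zero' (Eventually.of_forall fun _ => measureReal_nonneg)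
      (hbound.mono fun u h => h.1) hzero
  have hreal : Tendsto (fun u => ENNReal.ofReal (1 - (cond P (A u)).real (B u)ᶜ)) atTop (𝓝 1) := by
    simpa using ENNReal.tendsto_ofReal (hcompl.const_sub 1)
  refine hreal.congr' ?_
  filter_upwards [hbound] with u hu
  have hPA : P (A u) ≠ 0 := fun h0 => by simp [Measure.real, h0] at hu
  have := cond_isProbabilityMeasure hPA
  rw [← probReal_compl_eq_one_sub (hB u).compl, compl_compl, ofReal_measureReal]

end Concentration

theorem theorem1p2 {Ω : Type*} [MeasurableSpace Ω] (P : Measure Ω) [IsProbabilityMeasure P]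
    (τ : ℝ) (hτ : τ ∈ Set.Ioo (3 : ℝ) 4) (β : ℝ) (T : ℕ → Ω → ℝ)
    (hT_meas : ∀ i, 2 ≤ i → Measurable (T i))
    (hT_law : ∀ i, 2 ≤ i → P.map (T i) = expMeasure (coeffC τ i))
    (hT_indep : iIndepFun (fun i : {i : ℕ // 2 ≤ i} => T i) P) :
    -- `Λ` is well defined and `θ*` is its unique minimizer, and it is positive
    (∀ ϑ : ℝ, IntegrableOn (tiltF τ ϑ) (Set.Ioi 0)) ∧
    0 < thetaStar τ ∧
    (∀ ϑ : ℝ, ϑ ≠ thetaStar τ → tiltLambda τ (thetaStar τ) < tiltLambda τ ϑ) ∧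
    -- the integral defining `I_E` converges on `[0, 1]`
    (∀ a ∈ Set.Icc (0 : ℝ) 1, IntegrableOn (rateIntegrand τ (thetaStar τ) a) (Set.Ioi 0)) ∧
    -- the series defining `S_t` converges almost surely, for each time `t`
    (∀ t : ℝ, 0 ≤ t → ∀ᵐ ω ∂P, Tendsto (fun n : ℕ => thinnedLevyPartial τ β T n t ω) atTop
      (𝓝 (thinnedLevy τ β T t ω))) ∧
    -- the limit of the conditional probabilities
    (∀ ε : ℝ, 0 < ε → ∀ a ∈ Set.Icc (0 : ℝ) 1,
      Tendsto (fun u : ℝ =>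
          cond P {ω | 0 < thinnedLevy τ β T u ω}
            {ω | |thinnedLevy τ β T (a * u) ω - u ^ (τ - 2) * rateIE τ a| ≤ ε * u ^ (τ - 2)})
        atTop (𝓝 1)) := by
  have hT : IsClockFamily P τ T := ⟨hT_meas, hT_law, hT_indep⟩
  obtain ⟨hpos, hslope⟩ := thetaStar_spec hτ
  refine ⟨integrableOn_tiltF hτ, hpos, fun ϑ hϑ => ?_,
    fun a ha => integrableOn_rateIntegrand hτ ha,
    fun t ht => ae_tendsto_thinnedLevyPartial hτ hT ht,
    fun ε hε a ha => tendsto_cond_thinnedLevy hτ hT ha hε⟩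
  rw [tiltLambda_eq, tiltLambda_eq]
  exact limitCgf_lt_of_limitSlope_eq_zero hτ hslope hϑ
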